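/- Let $0\le d\le D$ be integers, let $\mathcal M\subset\mathbb R^D$ be a compact $d$-dimensional embedded $C^2$ submanifold without boundary, and let $\mathrm{Vol}_{\mathcal M}$ be its $d$-dimensional volume measure, that is, the $d$-dimensional Hausdorff measure (normalised to agree with Lebesgue measure on $\mathbb R^d$) restricted to $\mathcal M$. Let $\mathrm{Vol}$ be Lebesgue measure and let $B_k(x,r)$ be the open Euclidean ball in $\mathbb R^k$ with centre $x$ and radius $r$. For $r\ge 0$ put $\mathcal M_r=\{y\in\mathbb R^D:\inf_{x\in\mathcal M}\|x-y\|<r\}$, and let $$\tau=\sup\{r\ge 0:\text{ every } y\in\mathcal M_r \text{ has exactly one nearest point in }\mathcal M\}$$ be the reach of $\mathcal M$, assumed to be finite. Let $0\le\sigma<\tau$, and let $P:\mathcal M_\sigma\to\mathcal M$ map each point of $\mathcal M_\sigma$ to its unique nearest point in $\mathcal M$. (i) For every $\mathrm{Vol}_{\mathcal M}$-measurable (in particular every Borel) set $U\subseteq\mathcal M$, $$\Bigl(1-\frac{\sigma}{\tau}\Bigr)^d\,\mathrm{Vol}_{\mathcal M}(U)\,\mathrm{Vol}(B_{D-d}(0,\sigma))\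 \le\ \mathrm{Vol}(P^{-1}(U))\ \le\ \Bigl(1+\frac{\sigma}{\tau}\Bigr)^d\,\mathrm{Vol}_{\mathcal M}(U)\,\mathrm{Vol}(B_{D-d}(0,\sigma)).$$ (ii) For every $y\in\mathcal M$ and every real $r$ with $r+\sigma\le\tau/8$ (balls of radius $\le 0$ being empty), $$\mathrm{Vol}(\mathcal M_\sigma\cap B_D(y,r))\ \le\ \Bigl(1+\frac{\sigma}{\tau}\Bigr)^d\left(1+\Bigl(\frac{2(r+\sigma)}{\tau-2(r+\sigma)}\Bigr)^2\right)^{d/2}\mathrm{Vol}(B_d(0,r+\sigma))\,\mathrm{Vol}(B_{D-d}(0,\sigma)).$$ -/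

import Mathlib

open MeasureTheory

/-- `ℝⁿ` with its Euclidean norm. -/
abbrev EucSp (n : ℕ) : Type := EuclideanSpace ℝ (Fin n)

/-- `M ⊆ ℝᴰ` is a `d`-dimensional (embedded) `C²` submanifold without boundary: around each of its
points there is a `C²` diffeomorphism `φ` between an open subset of `ℝᴰ` and an open subset of
`ℝᵈ × ℝᴰ⁻ᵈ` that carries `M` to the slice `ℝᵈ × {0}`. -/
def IsC2Submanifold {D : ℕ} (d : ℕ) (M : Set (EucSp D)) : Prop :=
  ∀ p ∈ M, ∃ φ : OpenPartialHomeomorph (EucSp D) (EucSp d × EucSp (D - d)),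
    p ∈ φ.source ∧ ContDiffOn ℝ 2 φ φ.source ∧ ContDiffOn ℝ 2 φ.symm φ.target ∧
      ∀ x ∈ φ.source, x ∈ M ↔ (φ x).2 = 0

/-- `x` is a point of `M` at minimal distance from `y`. -/
def IsNearestPoint {D : ℕ} (M : Set (EucSp D)) (y x : EucSp D) : Prop :=
  x ∈ M ∧ dist x y = Metric.infDist y M

/-- The set of the points of `ℝᴰ` that have exactly one nearest point in `M`. -/
def uniqueNearestSet {D : ℕ} (M : Set (EucSp D)) : Set (EucSp D) :=
  {y | ∃! x, IsNearestPoint M y x}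

/-- The reach of `M`, the supremum in `[0, ∞]` of those `r ≥ 0` for which each point of the open
`r`-tube `{y | inf_{x ∈ M} ‖x - y‖ < r}` (`Metric.thickening r M`) has exactly one nearest point
in `M`. -/
noncomputable def reach {D : ℕ} (M : Set (EucSp D)) : ENNReal :=
  sSup (ENNReal.ofReal '' {r : ℝ | 0 ≤ r ∧ Metric.thickening r M ⊆ uniqueNearestSet M})

/-- The nearest-point projection onto `M` (a point of `M` nearest to `y`, if there is one). -/
noncomputable def nearestPointProj {D : ℕ} (M : Set (EucSp D)) (y : EucSp D) : EucSp D :=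
  Classical.epsilon (IsNearestPoint M y)

/-- Below the reach, each point of the tube has a unique nearest point. -/
theorem thickening_subset_uniqueNearestSet {D : ℕ} {M : Set (EucSp D)} {σ : ℝ}
    (h : ENNReal.ofReal σ < reach M) : Metric.thickening σ M ⊆ uniqueNearestSet M := by
  obtain ⟨_, ⟨r, ⟨_, hr⟩, rfl⟩, hσr⟩ := lt_sSup_iff.1 h
  have hlt : σ < r := lt_of_not_ge fun hle => absurd (ENNReal.ofReal_le_ofReal hle) (not_le.2 hσr)
  exact (Metric.thickening_mono hlt.le M).trans hr

/-- Below the reach, the projection is well defined on the tube: `nearestPointProj M y` is the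
one and only nearest point of `y` in `M`. -/
theorem isNearestPoint_iff_eq_nearestPointProj {D : ℕ} {M : Set (EucSp D)} {σ : ℝ}
    (h : ENNReal.ofReal σ < reach M) {y : EucSp D} (hy : y ∈ Metric.thickening σ M)
    (x : EucSp D) : IsNearestPoint M y x ↔ x = nearestPointProj M y := by
  have hu := thickening_subset_uniqueNearestSet h hy
  have hs : IsNearestPoint M y (nearestPointProj M y) := Classical.epsilon_spec hu.exists
  exact ⟨fun hx => hu.unique hx hs, fun hx => hx ▸ hs⟩

/-- The preimage `P⁻¹(U)` of `U` under the nearest-point projection `P : M_σ → M` from the open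
`σ`-tube `M_σ`. -/
def tubePreimage {D : ℕ} (M : Set (EucSp D)) (σ : ℝ) (U : Set (EucSp D)) : Set (EucSp D) :=
  {y | y ∈ Metric.thickening σ M ∧ nearestPointProj M y ∈ U}

/-- The `d`-dimensional volume measure of a `d`-dimensional submanifold `M` of `ℝᴰ`: the
`d`-dimensional Hausdorff measure (normalised so as to agree with Lebesgue measure on `ℝᵈ`),
restricted to `M`. -/
noncomputable def volM {D : ℕ} (d : ℕ) (M : Set (EucSp D)) : Measure (EucSp D) :=
  (Measure.euclideanHausdorffMeasure d : Measure (EucSp D)).restrict M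

/-! Near a point of $\mathcal M$ the tube is parametrised by $(w,t)\mapsto\psi(w)+\nu(w)t$, where
$\psi$ parametrises $\mathcal M$ and $\nu(w)$ is a normal frame. At a base point where both are
isometric to first order, the Jacobian is $|\det(I+S_t)|$ with $S_t$ the shape operator in the
normal direction $t$. Since $\|S_t\|\le\|t\|/\tau$, it lies between $(1-\|t\|/\tau)^d$ and
$(1+\|t\|/\tau)^d$, and (i) is the change of variables formula.

The curvature bound comes from the reach. Away from its foot point, the distance to $\mathcal M$
grows at unit speed, so a normal ray keeps its foot as nearest point up to length $\tau$
(`infDist_add_smul_eq_of_lt_reach`). Hence balls of radius below $\tau$ touching $\mathcal M$ at $a$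
miss $\mathcal M$, which is Federer's inequality $\langle q-a,v\rangle\le\|v\|\|q-a\|^2/(2\tau)$
(`IsProximalNormal.inner_le`). It makes the projection Lipschitz and, infinitesimally, bounds $S_t$
(`NormalParam.norm_shape_apply_le`).

All estimates are proved with slightly worse constants on small neighbourhoods, where $\psi$ and
$\nu$ distort by at most a factor $K$ close to 1. Compactness of $\mathcal M$ glues the
neighbourhoods together, and then the constants tend to their limits.

For (ii), $\mathcal M_\sigma\cap B(y,r)$ projects into $\mathcal M\cap B(y,\rho)$ with
$\rho=r+\sigma$, so by (i) it suffices to bound the area of that piece. Normal spaces turn at rate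
at most $1/\tau$ along $\mathcal M$. Together with Federer's inequality this keeps chords of the
piece close to the tangent space at $y$, so orthogonal projection to that space, whose image lies in
a $d$-ball of radius $\rho$, shrinks distances by a controlled factor only. -/

open Filter Topology Metric Set
open scoped NNReal ENNReal RealInnerProductSpace

/-! ### Metric consequences of the reach: normal rays, Federer's inequality, the projection. -/

section Reach

variable {D : ℕ} {M : Set (EucSp D)} {τ : ℝ}

theorem thickening_subset_uniqueNearestSet_of_le (h : ENNReal.ofReal τ ≤ reach M) :
    thickening τ M ⊆ uniqueNearestSet M := by
  intro y hy
  rcases M.eq_empty_or_nonempty with rfl | hne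
  · simp at hy
  have hy' : infDist y M < τ := (mem_thickening_iff_infDist_lt hne).1 hy
  obtain ⟨r, hr1, hr2⟩ := exists_between hy'
  have hr0 : 0 ≤ infDist y M := infDist_nonneg
  refine thickening_subset_uniqueNearestSet (σ := r)
    (lt_of_lt_of_le ?_ h) ((mem_thickening_iff_infDist_lt hne).2 hr1)
  exact (ENNReal.ofReal_lt_ofReal_iff (by linarith)).2 hr2

theorem isNearestPoint_nearestPointProj (H : thickening τ M ⊆ uniqueNearestSet M)
    {y : EucSp D} (hy : y ∈ thickening τ M) : IsNearestPoint M y (nearestPointProj M y) :=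
  Classical.epsilon_spec (H hy).exists

theorem IsNearestPoint.eq_nearestPointProj (H : thickening τ M ⊆ uniqueNearestSet M)
    {x y : EucSp D} (hy : y ∈ thickening τ M) (hx : IsNearestPoint M y x) :
    x = nearestPointProj M y :=
  (H hy).unique hx (isNearestPoint_nearestPointProj H hy)

theorem mem_thickening_of_infDist_lt (hne : M.Nonempty) {y : EucSp D} (h : infDist y M < τ) :
    y ∈ thickening τ M :=
  (mem_thickening_iff_infDist_lt hne).2 h

theorem infDist_lt_of_mem_thickening {y : EucSp D} (h : y ∈ thickening τ M) :
    infDist y M < τ := by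
  rcases M.eq_empty_or_nonempty with rfl | hne
  · simp at h
  · exact (mem_thickening_iff_infDist_lt hne).1 h

/-- By compactness the foot points cluster in `M`; every cluster point is a nearest point of the
limit, and there is only one. -/
theorem continuousOn_nearestPointProj (hM : IsCompact M)
    (H : thickening τ M ⊆ uniqueNearestSet M) :
    ContinuousOn (nearestPointProj M) (thickening τ M) := by
  intro y hy
  refine hM.tendsto_nhds_of_unique_mapClusterPt
    (eventually_mem_nhdsWithin.mono fun z hz => (isNearestPoint_nearestPointProj H hz).1) ?_
  intro x hxM hx
  refine IsNearestPoint.eq_nearestPointProj H hy ⟨hxM, ?_⟩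
  refine le_antisymm (le_of_forall_pos_le_add fun ε hε => ?_)
    (by rw [dist_comm]; exact infDist_le_dist_of_mem hxM)
  have h1 : ∃ᶠ z in 𝓝[thickening τ M] y, nearestPointProj M z ∈ ball x (ε / 3) :=
    hx.frequently (ball_mem_nhds x (by positivity))
  have h2 : ∀ᶠ z in 𝓝[thickening τ M] y, z ∈ ball y (ε / 3) ∧ z ∈ thickening τ M :=
    (eventually_nhdsWithin_of_eventually_nhds
      (ball_mem_nhds y (by positivity : 0 < ε / 3))).and eventually_mem_nhdsWithin
  obtain ⟨z, hz1, hz2, hz3⟩ := (h1.and_eventually h2).exists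
  have h3 := (isNearestPoint_nearestPointProj H hz3).2
  have h4 : infDist z M ≤ infDist y M + dist z y := infDist_le_infDist_add_dist
  have h5 := dist_triangle4 x (nearestPointProj M z) z y
  rw [mem_ball] at hz1 hz2
  rw [dist_comm] at hz1
  linarith

/-- Moving from a point of the tube away from its projection increases the distance to `M` at
almost unit speed. -/
theorem exists_infDist_add_smul_gt (hM : IsCompact M) (H : thickening τ M ⊆ uniqueNearestSet M)
    {y : EucSp D} (hy : y ∈ thickening τ M) (hy0 : 0 < infDist y M) {ε : ℝ} (hε : 0 < ε) :
    ∃ u : EucSp D, ‖u‖ = 1 ∧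
      ∀ᶠ h in 𝓝[>] (0 : ℝ), infDist y M + (1 - ε) * h ≤ infDist (y + h • u) M := by
  set p := nearestPointProj M y with hp
  have hpn := isNearestPoint_nearestPointProj H hy
  have hne : M.Nonempty := ⟨p, hpn.1⟩
  have hyp : ‖y - p‖ = infDist y M := by rw [← hpn.2, dist_comm, dist_eq_norm]
  have hyp0 : 0 < ‖y - p‖ := by rw [hyp]; exact hy0
  set u := ‖y - p‖⁻¹ • (y - p) with hu
  have hu1 : ‖u‖ = 1 := by
    rw [hu, norm_smul, norm_inv, norm_norm, inv_mul_cancel₀ hyp0.ne']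
  refine ⟨u, hu1, ?_⟩
  have hcurve : Tendsto (fun h : ℝ => y + h • u) (𝓝[>] 0) (𝓝 y) := by
    have : Continuous fun h : ℝ => y + h • u := by fun_prop
    have h2 := this.tendsto 0
    simp only [zero_smul, add_zero] at h2
    exact h2.mono_left nhdsWithin_le_nhds
  have hopen : thickening τ M ∈ 𝓝 y := isOpen_thickening.mem_nhds hy
  have hP : Tendsto (fun h : ℝ => nearestPointProj M (y + h • u)) (𝓝[>] 0) (𝓝 p) :=
    ((continuousOn_nearestPointProj hM H).continuousAt hopen).tendsto.comp hcurve
  -- By continuity of the projection, the unit vector from the foot point of `y + h • u` towards `y`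
  -- tends to `u`. Its inner product with `u` is therefore eventually above `1 - ε`, which is the
  -- speed gained below.
  have hinner : Tendsto (fun h : ℝ =>
      ⟪u, ‖y - nearestPointProj M (y + h • u)‖⁻¹ • (y - nearestPointProj M (y + h • u))⟫)
      (𝓝[>] 0) (𝓝 1) := by
    have h1 : Tendsto (fun h : ℝ => y - nearestPointProj M (y + h • u)) (𝓝[>] 0) (𝓝 (y - p)) :=
      tendsto_const_nhds.sub hP
    have h2 := (tendsto_const_nhds (x := u)).inner (𝕜 := ℝ) ((h1.norm.inv₀ hyp0.ne').smul h1)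
    have h3 : ⟪u, u⟫ = 1 := by rw [real_inner_self_eq_norm_sq, hu1]; norm_num
    rw [← h3]
    exact h2
  filter_upwards [hinner.eventually (lt_mem_nhds (show 1 - ε < 1 by linarith)),
    hcurve.eventually hopen, self_mem_nhdsWithin] with h h1 h2 h3
  have h0 : (0 : ℝ) < h := h3
  set q := nearestPointProj M (y + h • u) with hq
  have hqn := isNearestPoint_nearestPointProj H h2
  rw [← hqn.2, dist_comm, dist_eq_norm]
  have h4 : infDist y M ≤ ‖y - q‖ := by
    rw [← dist_eq_norm]; exact infDist_le_dist_of_mem hqn.1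
  have hyq : 0 < ‖y - q‖ := lt_of_lt_of_le hy0 h4
  set n := ‖y - q‖⁻¹ • (y - q) with hn
  have hn1 : ‖n‖ = 1 := by
    rw [hn, norm_smul, norm_inv, norm_norm, inv_mul_cancel₀ hyq.ne']
  have h5 : ⟪y + h • u - q, n⟫ ≤ ‖y + h • u - q‖ := by
    simpa [hn1] using real_inner_le_norm (y + h • u - q) n
  have h6 : ⟪y + h • u - q, n⟫ = ‖y - q‖ + h * ⟪u, n⟫ := by
    rw [show y + h • u - q = (y - q) + h • u by abel, inner_add_left, real_inner_smul_left]
    congr 1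
    rw [hn, real_inner_smul_right, real_inner_self_eq_norm_sq]
    field_simp
  nlinarith [mul_le_mul_of_nonneg_left h1.le h0.le]

/-- Gluing the short moves of `exists_infDist_add_smul_gt` by continuous induction gives, for each
`ε`, a point of the ball that has gained `(1 - ε) * T`. A maximiser of the distance over the ball
serves all `ε` at once. -/
theorem exists_infDist_ge (hM : IsCompact M) (hne : M.Nonempty)
    (H : thickening τ M ⊆ uniqueNearestSet M)
    {z : EucSp D} (hz0 : 0 < infDist z M) {T : ℝ} (hT : 0 ≤ T) (hTτ : infDist z M + T < τ) :
    ∃ y, dist y z ≤ T ∧ infDist z M + T ≤ infDist y M := by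
  obtain ⟨y, hy, hymax⟩ := (isCompact_closedBall z T).exists_isMaxOn
    ⟨z, mem_closedBall_self hT⟩ (continuous_infDist_pt M).continuousOn
  refine ⟨y, hy, le_of_forall_pos_le_add fun η hη => ?_⟩
  set ε := min (η / (T + 1)) (1 / 2) with hεdef
  have hε : 0 < ε := lt_min (by positivity) (by norm_num)
  have hε1 : ε ≤ 1 / 2 := min_le_right _ _
  have hεT : ε * T ≤ η := by
    have h1 : ε * T ≤ (η / (T + 1)) * T := mul_le_mul_of_nonneg_right (min_le_left _ _) hT
    have h2 : (η / (T + 1)) * T ≤ η := by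
      rw [div_mul_eq_mul_div, div_le_iff₀ (by linarith)]; nlinarith
    linarith
  set S : Set ℝ := {t | ∃ x, dist x z ≤ t ∧ infDist z M + (1 - ε) * t ≤ infDist x M} with hS
  suffices hsub : Icc 0 T ⊆ S by
    obtain ⟨x, hx1, hx2⟩ := hsub (right_mem_Icc.2 hT)
    have h3 : infDist x M ≤ infDist y M := hymax hx1
    nlinarith
  refine IsClosed.Icc_subset_of_forall_exists_gt ?_ ?_ ?_
  -- The set of reachable times is closed because it is the projection of a compact set of pairs
  -- (time, point).
  · have : S ∩ Icc 0 T = Prod.fst '' ((Icc 0 T ×ˢ closedBall z T) ∩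
        {q : ℝ × EucSp D | dist q.2 z ≤ q.1 ∧
          infDist z M + (1 - ε) * q.1 ≤ infDist q.2 M}) := by
      ext t
      constructor
      · rintro ⟨⟨x, hx1, hx2⟩, ht⟩
        exact ⟨(t, x), ⟨⟨ht, hx1.trans ht.2⟩, hx1, hx2⟩, rfl⟩
      · rintro ⟨⟨t', x⟩, ⟨⟨ht, -⟩, hx1, hx2⟩, rfl⟩
        exact ⟨⟨x, hx1, hx2⟩, ht⟩
    rw [this]
    refine (((isCompact_Icc.prod (isCompact_closedBall z T)).inter_right ?_).image
      continuous_fst).isClosed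
    refine IsClosed.and ?_ ?_
    · exact isClosed_le (by fun_prop) (by fun_prop)
    · exact isClosed_le (by fun_prop) ((continuous_infDist_pt M).comp continuous_snd)
  · exact ⟨z, by simp, by simp⟩
  · rintro t ⟨⟨x, hx1, hx2⟩, ht0, htT⟩ t' (htt' : t < t')
    have hxτ : infDist x M < τ := by
      have : infDist x M ≤ infDist z M + dist x z := infDist_le_infDist_add_dist
      linarith
    have hx0 : 0 < infDist x M := by nlinarith
    obtain ⟨u, hu1, hu⟩ := exists_infDist_add_smul_gt hM H
      (mem_thickening_of_infDist_lt hne hxτ) hx0 hε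
    obtain ⟨h, hh1, hh2⟩ := (hu.and (Ioo_mem_nhdsGT (show 0 < t' - t by linarith))).exists
    refine ⟨t + h, ⟨x + h • u, ?_, by nlinarith⟩, by linarith [hh2.1], by linarith [hh2.2]⟩
    have : dist (x + h • u) x = h := by
      rw [dist_eq_norm, add_sub_cancel_left, norm_smul, hu1, mul_one, Real.norm_eq_abs,
        abs_of_pos hh2.1]
    linarith [dist_triangle (x + h • u) x z]

/-- For `r ≤ t` this is the triangle inequality. For `r > t`, some `y` within `r - t` of `a + t • v`
has distance at least `r` from `M`, hence from `a`; equality in the triangle inequality forces `y =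
a + r • v`. -/
theorem infDist_add_smul_eq_of_lt_reach (hM : IsCompact M)
    (H : thickening τ M ⊆ uniqueNearestSet M) {a v : EucSp D} (ha : a ∈ M) (hv : ‖v‖ = 1)
    {t : ℝ} (ht : 0 < t) (hat : infDist (a + t • v) M = t) {r : ℝ} (hr : 0 ≤ r) (hrτ : r < τ) :
    infDist (a + r • v) M = r := by
  have hdist : ∀ s s' : ℝ, dist (a + s • v) (a + s' • v) = |s - s'| := fun s s' => by
    rw [dist_eq_norm, add_sub_add_left_eq_sub, ← sub_smul, norm_smul, hv, mul_one,
      Real.norm_eq_abs]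
  have hle : infDist (a + r • v) M ≤ r := by
    have h1 : infDist (a + r • v) M ≤ dist (a + r • v) a := infDist_le_dist_of_mem ha
    have h2 := hdist r 0
    rw [zero_smul, add_zero, sub_zero, abs_of_nonneg hr] at h2
    linarith
  refine le_antisymm hle ?_
  rcases le_total r t with hrt | hrt
  · have h1 : infDist (a + t • v) M ≤ infDist (a + r • v) M + dist (a + t • v) (a + r • v) :=
      infDist_le_infDist_add_dist
    rw [hdist, abs_of_nonneg (by linarith)] at h1
    linarith
  · obtain ⟨y, hy1, hy2⟩ := exists_infDist_ge hM ⟨a, ha⟩ H (z := a + t • v) (by rw [hat]; exact ht)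
      (T := r - t) (by linarith) (by rw [hat]; linarith)
    rw [hat] at hy2
    have hy3 : infDist y M ≤ ‖y - a‖ := by
      rw [← dist_eq_norm]; exact infDist_le_dist_of_mem ha
    set x := y - (a + t • v) with hx
    have hx1 : ‖x‖ ≤ r - t := by rw [hx, ← dist_eq_norm]; exact hy1
    have hxa : y - a = x + t • v := by rw [hx]; abel
    have h4 : ‖y - a‖ ^ 2 = ‖x‖ ^ 2 + 2 * (t * ⟪x, v⟫) + t ^ 2 := by
      rw [hxa, norm_add_sq_real, real_inner_smul_right, norm_smul, hv]
      simp
    have h5 : r ^ 2 ≤ ‖y - a‖ ^ 2 := by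
      have : r ≤ ‖y - a‖ := by linarith
      gcongr
    have hx2 : ‖x‖ ^ 2 ≤ (r - t) ^ 2 := by gcongr
    have h6 : r - t ≤ ⟪x, v⟫ := by
      have : t * (r - t) ≤ t * ⟪x, v⟫ := by nlinarith
      exact le_of_mul_le_mul_left this ht
    have h7 : ‖x - (r - t) • v‖ ^ 2 ≤ 0 := by
      rw [norm_sub_sq_real, real_inner_smul_right, norm_smul, hv, mul_one, Real.norm_eq_abs,
        sq_abs]
      nlinarith
    have h8 : x = (r - t) • v := by
      have := pow_eq_zero_iff (two_ne_zero) |>.1 (le_antisymm h7 (sq_nonneg _))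
      exact sub_eq_zero.1 (norm_eq_zero.1 this)
    have h9 : y = a + r • v := by
      rw [hx, sub_eq_iff_eq_add] at h8
      rw [h8]; module
    rw [← h9]; linarith

/-- `v` is a proximal normal vector of `M` at `a`: the point `a` of `M` is nearest to `a + s v` for
some `s > 0`. -/
def IsProximalNormal (M : Set (EucSp D)) (a v : EucSp D) : Prop :=
  ∃ s : ℝ, 0 < s ∧ IsNearestPoint M (a + s • v) a

theorem IsProximalNormal.infDist_add (hM : IsCompact M)
    (H : thickening τ M ⊆ uniqueNearestSet M) {a v : EucSp D} (h : IsProximalNormal M a v)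
    (hv : ‖v‖ < τ) : infDist (a + v) M = ‖v‖ := by
  obtain ⟨s, hs, ha, had⟩ := h
  rcases eq_or_ne v 0 with rfl | hv0
  · simp [infDist_zero_of_mem ha]
  have hvn : 0 < ‖v‖ := norm_pos_iff.2 hv0
  have key := infDist_add_smul_eq_of_lt_reach hM H ha (v := ‖v‖⁻¹ • v)
    (by rw [norm_smul, norm_inv, norm_norm, inv_mul_cancel₀ hvn.ne']) (t := s * ‖v‖)
    (by positivity) ?_ (norm_nonneg v) hv
  · rwa [smul_smul, mul_inv_cancel₀ hvn.ne', one_smul] at key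
  · rw [smul_smul, mul_assoc, mul_inv_cancel₀ hvn.ne', mul_one, ← had, dist_eq_norm]
    simp [norm_smul, abs_of_pos hs]

theorem IsProximalNormal.mem {a v : EucSp D} (hv : IsProximalNormal M a v) : a ∈ M := by
  obtain ⟨s, hs, ha, had⟩ := hv
  exact ha

theorem IsProximalNormal.nearestPointProj_add (hM : IsCompact M)
    (H : thickening τ M ⊆ uniqueNearestSet M) {a v : EucSp D} (h : IsProximalNormal M a v)
    (hv : ‖v‖ < τ) : nearestPointProj M (a + v) = a := by
  have h1 := h.infDist_add hM H hv
  refine (IsNearestPoint.eq_nearestPointProj H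
    (mem_thickening_of_infDist_lt ⟨a, h.mem⟩ (h1 ▸ hv)) ⟨h.mem, ?_⟩).symm
  rw [h1, dist_eq_norm]; simp

/-- Federer's inequality: for `r < τ` the open ball of radius `r` touching `M` at `a` on the side of
`v` does not contain `q`. Expanding the square and letting `r` tend to `τ` gives the bound. -/
theorem IsProximalNormal.inner_le (hM : IsCompact M)
    (H : thickening τ M ⊆ uniqueNearestSet M) (hτ : 0 < τ) {a v q : EucSp D}
    (h : IsProximalNormal M a v) (hq : q ∈ M) :
    ⟪q - a, v⟫ ≤ ‖v‖ * ‖q - a‖ ^ 2 / (2 * τ) := by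
  obtain ⟨s, hs, ha, had⟩ := h
  rcases eq_or_ne v 0 with rfl | hv0
  · simp
  have hvn : 0 < ‖v‖ := norm_pos_iff.2 hv0
  have key : ∀ r ∈ Ioo 0 τ, 2 * r * ⟪q - a, v⟫ ≤ ‖v‖ * ‖q - a‖ ^ 2 := by
    intro r hr
    have hn : ‖(r / ‖v‖) • v‖ = r := by
      rw [norm_smul, norm_div, norm_norm, Real.norm_eq_abs, abs_of_pos hr.1]; field_simp
    have hp : IsProximalNormal M a ((r / ‖v‖) • v) := by
      refine ⟨s * ‖v‖ / r, div_pos (by positivity) hr.1, ha, ?_⟩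
      rw [smul_smul, show s * ‖v‖ / r * (r / ‖v‖) = s by have := hr.1; field_simp]
      exact had
    have h1 := hp.infDist_add hM H (by rw [hn]; exact hr.2)
    have h2 : ‖(r / ‖v‖) • v‖ ≤ ‖(q - a) - (r / ‖v‖) • v‖ := by
      rw [← h1, ← norm_neg (q - a - (r / ‖v‖) • v), show -(q - a - (r / ‖v‖) • v) = a + (r / ‖v‖) • v - q by abel,
        ← dist_eq_norm]
      exact infDist_le_dist_of_mem hq
    have h3 := pow_le_pow_left₀ (norm_nonneg _) h2 2
    rw [norm_sub_sq_real (q - a), real_inner_smul_right] at h3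
    have h4 : 2 * (r / ‖v‖ * ⟪q - a, v⟫) ≤ ‖q - a‖ ^ 2 := by linarith
    have h5 := mul_le_mul_of_nonneg_left h4 hvn.le
    calc _ = ‖v‖ * (2 * (r / ‖v‖ * ⟪q - a, v⟫)) := by field_simp
      _ ≤ _ := h5
  have hlim : Tendsto (fun r : ℝ => 2 * r * ⟪q - a, v⟫) (𝓝[<] τ) (𝓝 (2 * τ * ⟪q - a, v⟫)) := by
    have : Continuous fun r : ℝ => 2 * r * ⟪q - a, v⟫ := by fun_prop
    exact (this.tendsto τ).mono_left nhdsWithin_le_nhds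
  have := le_of_tendsto hlim (by filter_upwards [Ioo_mem_nhdsLT hτ] with r hr using key r hr)
  rw [le_div_iff₀ (by positivity)]
  linarith

/-- The projection onto `M` is Lipschitz on each tube below the reach. -/
theorem norm_nearestPointProj_sub_le (hM : IsCompact M)
    (H : thickening τ M ⊆ uniqueNearestSet M) (hτ : 0 < τ) {r : ℝ}
    {y z : EucSp D} (hy : y ∈ thickening τ M) (hz : z ∈ thickening τ M)
    (hyr : infDist y M ≤ r) (hzr : infDist z M ≤ r) :
    (1 - r / τ) * ‖nearestPointProj M y - nearestPointProj M z‖ ≤ ‖y - z‖ := by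
  have hyn := isNearestPoint_nearestPointProj H hy
  have hzn := isNearestPoint_nearestPointProj H hz
  set a := nearestPointProj M y
  set b := nearestPointProj M z
  have hpa : IsProximalNormal M a (y - a) := ⟨1, one_pos, by simpa using hyn⟩
  have hpb : IsProximalNormal M b (z - b) := ⟨1, one_pos, by simpa using hzn⟩
  have h1 := hpa.inner_le hM H hτ hzn.1
  have h2 := hpb.inner_le hM H hτ hyn.1
  rw [norm_sub_rev b a] at h1
  have hna : ‖y - a‖ ≤ r := by rw [← dist_eq_norm, dist_comm, hyn.2]; exact hyr
  have hnb : ‖z - b‖ ≤ r := by rw [← dist_eq_norm, dist_comm, hzn.2]; exact hzr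
  -- The projection is almost monotone: each of the two cross terms costs at most `r / (2 * τ) * ‖a
  -- - b‖ ^ 2`, by Federer's inequality at `a` and at `b`.
  have h3 : ⟪a - b, y - z⟫ = ‖a - b‖ ^ 2 - ⟪b - a, y - a⟫ - ⟪a - b, z - b⟫ := by
    rw [show y - z = (a - b) + (y - a) - (z - b) by abel, inner_sub_right, inner_add_right,
      real_inner_self_eq_norm_sq, ← neg_sub a b, inner_neg_left]
    ring
  have h4 : ⟪a - b, y - z⟫ ≤ ‖a - b‖ * ‖y - z‖ := real_inner_le_norm _ _
  have h5 : ‖y - a‖ * ‖a - b‖ ^ 2 / (2 * τ) ≤ r * ‖a - b‖ ^ 2 / (2 * τ) := by gcongr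
  have h6 : ‖z - b‖ * ‖a - b‖ ^ 2 / (2 * τ) ≤ r * ‖a - b‖ ^ 2 / (2 * τ) := by gcongr
  have h7 : r * ‖a - b‖ ^ 2 / (2 * τ) = r / τ * ‖a - b‖ ^ 2 / 2 := by field_simp
  rcases (norm_nonneg (a - b)).eq_or_lt with h0 | h0
  · rw [← h0, mul_zero]; positivity
  · refine le_of_mul_le_mul_left ?_ h0
    nlinarith

end Reach

/-! ### Local parametrisations with normal frames. -/

section Param

variable {D : ℕ} {d : ℕ}

/-- A linear change of the source, which makes a parametrisation or a frame isometric at the base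
point. -/
theorem exists_comp_eq_linearIsometry {k : ℕ} (A : EucSp k →L[ℝ] EucSp D)
    (hA : Function.Injective A) :
    ∃ (L : EucSp k ≃L[ℝ] EucSp k) (J : EucSp k →ₗᵢ[ℝ] EucSp D), ∀ x, A (L x) = J x := by
  have hfr : Module.finrank ℝ (LinearMap.range A.toLinearMap) = k := by
    rw [LinearMap.finrank_range_of_inj hA, finrank_euclideanSpace_fin]
  let e : EucSp k ≃ₗ[ℝ] LinearMap.range A.toLinearMap := LinearEquiv.ofInjective A.toLinearMap hA
  let b : EucSp k ≃ₗᵢ[ℝ] LinearMap.range A.toLinearMap :=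
    (stdOrthonormalBasis ℝ (LinearMap.range A.toLinearMap)).reindex (finCongr hfr) |>.repr.symm
  refine ⟨(b.toLinearEquiv.trans e.symm).toContinuousLinearEquiv,
    (LinearMap.range A.toLinearMap).subtypeₗᵢ.comp b.toLinearIsometry, fun x => ?_⟩
  have h : e (e.symm (b x)) = b x := e.apply_symm_apply _
  exact congrArg Subtype.val h

theorem isBoundedLinearMap_adjoint {E F : Type*} [NormedAddCommGroup E] [InnerProductSpace ℝ E]
    [NormedAddCommGroup F] [InnerProductSpace ℝ F] [CompleteSpace E] [CompleteSpace F] :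
    IsBoundedLinearMap ℝ (fun A : E →L[ℝ] F => ContinuousLinearMap.adjoint A) :=
  IsLinearMap.with_bound ⟨fun A B => map_add _ A B, fun c A => by simp⟩ 1 fun A => by simp

/-- A local parametrisation `ψ` of `M` at `p` together with a frame `ν` of normal vectors, which are
orthonormal to first order at `p`. -/
structure NormalParam (d : ℕ) (M : Set (EucSp D)) (p : EucSp D) where
  ψ : EucSp d → EucSp D
  ν : EucSp d → EucSp (D - d) →L[ℝ] EucSp D
  W : Set (EucSp d)
  JT : EucSp d →ₗᵢ[ℝ] EucSp D
  JN : EucSp (D - d) →ₗᵢ[ℝ] EucSp D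
  isOpen_W : IsOpen W
  zero_mem : 0 ∈ W
  ψ_zero : ψ 0 = p
  exists_image_eq : ∀ V ⊆ W, IsOpen V → ∃ O, IsOpen O ∧ ψ '' V = M ∩ O
  injOn : InjOn ψ W
  contDiffOn_ψ : ContDiffOn ℝ 2 ψ W
  contDiffOn_ν : ContDiffOn ℝ 1 ν W
  fderiv_ψ_zero : fderiv ℝ ψ 0 = JT.toContinuousLinearMap
  ν_zero : ν 0 = JN.toContinuousLinearMap
  injective_fderiv : ∀ w ∈ W, Function.Injective (fderiv ℝ ψ w)
  injective_ν : ∀ w ∈ W, Function.Injective (ν w)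
  inner_eq_zero : ∀ w ∈ W, ∀ u t, ⟪fderiv ℝ ψ w u, ν w t⟫ = 0
  isProximalNormal : ∀ w ∈ W, ∀ t, IsProximalNormal M (ψ w) (ν w t)

/-- The derivative of a `C²` map is locally Lipschitz, so the mean value inequality on the ball of
radius `‖q - x‖` gives a quadratic remainder. -/
theorem exists_norm_sub_fderiv_le {E F : Type*} [NormedAddCommGroup E] [NormedSpace ℝ E]
    [NormedAddCommGroup F] [NormedSpace ℝ F] {g : E → F} {x : E} (hg : ContDiffAt ℝ 2 g x) :
    ∃ K : ℝ, 0 ≤ K ∧ ∃ ρ > 0, ∀ q ∈ ball x ρ,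
      ‖g q - g x - fderiv ℝ g x (q - x)‖ ≤ K * ‖q - x‖ ^ 2 := by
  have h1 : ContDiffAt ℝ 1 (fderiv ℝ g) x := hg.fderiv_right (by norm_num)
  obtain ⟨K, s, hs, hK⟩ := h1.exists_lipschitzOnWith
  have h2 : ∀ᶠ y in 𝓝 x, DifferentiableAt ℝ g y :=
    (hg.eventually (by simp)).mono fun y hy => hy.differentiableAt (by norm_num)
  obtain ⟨ρ, hρ, hsub⟩ := Metric.mem_nhds_iff.1 (inter_mem hs h2)
  refine ⟨K, K.2, ρ, hρ, fun q hq => ?_⟩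
  have hsub' : closedBall x ‖q - x‖ ⊆ ball x ρ := closedBall_subset_ball (by
    rwa [mem_ball, dist_eq_norm] at hq)
  have h3 := (convex_closedBall x ‖q - x‖).norm_image_sub_le_of_norm_hasFDerivWithin_le'
    (f := g) (f' := fderiv ℝ g) (φ := fderiv ℝ g x) (C := K * ‖q - x‖) (x := x) (y := q)
    (fun y hy => ((hsub (hsub' hy)).2).hasFDerivAt.hasFDerivWithinAt)
    (fun y hy => by
      have := hK.dist_le_mul y (hsub (hsub' hy)).1 x (hsub (mem_ball_self hρ)).1
      rw [dist_eq_norm, dist_eq_norm] at this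
      rw [mem_closedBall, dist_eq_norm] at hy
      exact this.trans (by gcongr))
    (mem_closedBall_self (norm_nonneg _)) (by rw [mem_closedBall, dist_eq_norm])
  calc _ ≤ _ := h3
    _ = _ := by ring

theorem isProximalNormal_of_inner_le {M : Set (EucSp D)} {x v : EucSp D} (hx : x ∈ M) {C ρ : ℝ}
    (hC : 0 ≤ C) (hρ : 0 < ρ) (h : ∀ q ∈ M, q ∈ ball x ρ → ⟪q - x, v⟫ ≤ C * ‖q - x‖ ^ 2) :
    IsProximalNormal M x v := by
  -- The first entry makes `2 * s * C ≤ 1`, for points inside the ball; the second makes `2 * s *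
  -- ‖v‖ ≤ ρ`, so that Cauchy–Schwarz suffices outside it.
  set s := min (1 / (2 * C + 1)) (ρ / (2 * ‖v‖ + 1)) with hs
  have hs0 : 0 < s := by
    rw [hs]; exact lt_min (by positivity) (by positivity)
  have hs1 : s * (2 * C + 1) ≤ 1 := by
    rw [← le_div_iff₀ (by positivity), hs]; exact min_le_left _ _
  have hs2 : s * (2 * ‖v‖ + 1) ≤ ρ := by
    rw [← le_div_iff₀ (by positivity), hs]; exact min_le_right _ _
  refine ⟨s, hs0, hx, le_antisymm ?_ (by rw [dist_comm]; exact infDist_le_dist_of_mem hx)⟩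
  refine (le_infDist ⟨x, hx⟩).2 fun q hq => ?_
  have key : 2 * (s * ⟪q - x, v⟫) ≤ ‖q - x‖ ^ 2 := by
    by_cases hqρ : q ∈ ball x ρ
    · have h1 := mul_le_mul_of_nonneg_left (h q hq hqρ) hs0.le
      nlinarith [sq_nonneg ‖q - x‖]
    · rw [mem_ball, dist_eq_norm, not_lt] at hqρ
      have h1 := mul_le_mul_of_nonneg_left (real_inner_le_norm (q - x) v) hs0.le
      have h2 : 2 * s * ‖v‖ ≤ ‖q - x‖ := by nlinarith [norm_nonneg v]
      nlinarith [norm_nonneg (q - x)]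
  rw [dist_eq_norm, dist_eq_norm, show x - (x + s • v) = -(s • v) by abel, norm_neg,
    ← norm_neg (x + s • v - q), show -(x + s • v - q) = (q - x) - s • v by abel]
  refine le_of_sq_le_sq ?_ (norm_nonneg _)
  rw [norm_sub_sq_real (q - x), real_inner_smul_right]
  linarith

variable {M : Set (EucSp D)} {φ : OpenPartialHomeomorph (EucSp D) (EucSp d × EucSp (D - d))}

/-- The defining function vanishes on `M`, so its derivative at `x` applied to a chord `q - x` is of
second order. Here `C²` is what gives a ball of positive radius touching at `x`. -/
theorem isProximalNormal_adjoint_fderiv (hφ : ContDiffOn ℝ 2 φ φ.source)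
    (hM : ∀ x ∈ φ.source, x ∈ M ↔ (φ x).2 = 0) {x : EucSp D} (hx : x ∈ φ.source) (hxM : x ∈ M)
    (t : EucSp (D - d)) :
    IsProximalNormal M x (ContinuousLinearMap.adjoint (fderiv ℝ (fun y => (φ y).2) x) t) := by
  have hg : ContDiffAt ℝ 2 (fun y => (φ y).2) x :=
    contDiffAt_snd.comp x (hφ.contDiffAt (φ.open_source.mem_nhds hx))
  obtain ⟨K, hK, ρ, hρ, h⟩ := exists_norm_sub_fderiv_le hg
  obtain ⟨ρ', hρ', hsub⟩ := Metric.mem_nhds_iff.1 (φ.open_source.mem_nhds hx)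
  refine isProximalNormal_of_inner_le hxM (C := K * ‖t‖) (by positivity) (lt_min hρ hρ')
    fun q hq hqb => ?_
  have h1 := h q (ball_subset_ball (min_le_left _ _) hqb)
  have hqs : q ∈ φ.source := hsub (ball_subset_ball (min_le_right _ _) hqb)
  simp only [(hM q hqs).1 hq, (hM x hx).1 hxM, sub_zero, zero_sub, norm_neg] at h1
  rw [ContinuousLinearMap.adjoint_inner_right]
  refine (real_inner_le_norm _ _).trans ?_
  nlinarith [norm_nonneg t]

theorem hasFDerivAt_symm_comp_mk (hφ' : ContDiffOn ℝ 2 φ.symm φ.target) {w : EucSp d}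
    (hw : (w, (0 : EucSp (D - d))) ∈ φ.target) :
    HasFDerivAt (fun w : EucSp d => φ.symm (w, 0))
      ((fderiv ℝ φ.symm (w, 0)).comp (ContinuousLinearMap.inl ℝ _ _)) w := by
  have h1 : HasFDerivAt φ.symm (fderiv ℝ φ.symm (w, 0)) (w, 0) :=
    ((hφ'.contDiffAt (φ.open_target.mem_nhds hw)).differentiableAt (by norm_num)).hasFDerivAt
  have h2 : HasFDerivAt (fun w : EucSp d => (w, (0 : EucSp (D - d))))
      (ContinuousLinearMap.inl ℝ _ _) w := by
    simpa using hasFDerivAt_prodMk_left w (0 : EucSp (D - d))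
  exact h1.comp w h2

theorem fderiv_comp_fderiv_symm (hφ : ContDiffOn ℝ 2 φ φ.source)
    (hφ' : ContDiffOn ℝ 2 φ.symm φ.target) {z : EucSp d × EucSp (D - d)} (hz : z ∈ φ.target) :
    (fderiv ℝ φ (φ.symm z)).comp (fderiv ℝ φ.symm z) = ContinuousLinearMap.id ℝ _ := by
  have h1 : HasFDerivAt φ.symm (fderiv ℝ φ.symm z) z :=
    ((hφ'.contDiffAt (φ.open_target.mem_nhds hz)).differentiableAt (by norm_num)).hasFDerivAt
  have h2 : HasFDerivAt φ (fderiv ℝ φ (φ.symm z)) (φ.symm z) :=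
    ((hφ.contDiffAt (φ.open_source.mem_nhds (φ.map_target hz))).differentiableAt
      (by norm_num)).hasFDerivAt
  have h3 := h2.comp z h1
  have h4 : (φ ∘ φ.symm) =ᶠ[𝓝 z] id := by
    filter_upwards [φ.open_target.mem_nhds hz] with y hy using φ.right_inv hy
  exact (h3.congr_of_eventuallyEq h4.symm).unique (hasFDerivAt_id z)

theorem fderiv_snd_comp (hφ : ContDiffOn ℝ 2 φ φ.source) {x : EucSp D} (hx : x ∈ φ.source) :
    fderiv ℝ (fun y => (φ y).2) x = (ContinuousLinearMap.snd ℝ _ _).comp (fderiv ℝ φ x) := by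
  have h2 : HasFDerivAt φ (fderiv ℝ φ x) x :=
    ((hφ.contDiffAt (φ.open_source.mem_nhds hx)).differentiableAt (by norm_num)).hasFDerivAt
  exact h2.snd.fderiv

/-- The frame is the adjoint of the derivative of the defining function. It is injective because
that derivative is onto, and normal because the defining function is constant along `ψ₀`. The linear
changes `L` and `L'` make both isometric at the base point. -/
theorem nonempty_normalParam (hMd : IsC2Submanifold d M) {p : EucSp D} (hp : p ∈ M) :
    Nonempty (NormalParam d M p) := by
  obtain ⟨φ, hpφ, hφ, hφ', hM⟩ := hMd p hp
  set w₀ := (φ p).1 with hw₀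
  have hφp : φ p = (w₀, 0) := Prod.ext rfl ((hM p hpφ).1 hp)
  set ψ₀ : EucSp d → EucSp D := fun w => φ.symm (w, 0) with hψ₀
  set W₀ : Set (EucSp d) := {w | (w, (0 : EucSp (D - d))) ∈ φ.target} with hW₀
  set ν₀ : EucSp d → EucSp (D - d) →L[ℝ] EucSp D := fun w =>
    ContinuousLinearMap.adjoint (fderiv ℝ (fun y => (φ y).2) (ψ₀ w)) with hν₀
  have hW₀o : IsOpen W₀ := φ.open_target.preimage (by fun_prop)
  have hw₀W : w₀ ∈ W₀ := by
    rw [hW₀, mem_ofPred_eq, ← hφp]; exact φ.map_source hpφ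
  have hsrc : ∀ w ∈ W₀, ψ₀ w ∈ φ.source := fun w hw => φ.map_target hw
  have hφψ : ∀ w ∈ W₀, φ (ψ₀ w) = (w, 0) := fun w hw => φ.right_inv hw
  have hψM : ∀ w ∈ W₀, ψ₀ w ∈ M := fun w hw => (hM _ (hsrc w hw)).2 (by rw [hφψ w hw])
  have hD : ∀ w ∈ W₀, fderiv ℝ ψ₀ w =
      (fderiv ℝ φ.symm (w, 0)).comp (ContinuousLinearMap.inl ℝ _ _) :=
    fun w hw => (hasFDerivAt_symm_comp_mk hφ' hw).fderiv
  have hBA : ∀ w ∈ W₀, ∀ z, fderiv ℝ φ (ψ₀ w) (fderiv ℝ φ.symm (w, 0) z) = z := fun w hw z =>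
    DFunLike.congr_fun (fderiv_comp_fderiv_symm hφ hφ' hw) z
  have hinjD : ∀ w ∈ W₀, Function.Injective (fderiv ℝ ψ₀ w) := by
    intro w hw u u' huu
    rw [hD w hw] at huu
    have := congrArg (fderiv ℝ φ (ψ₀ w)) huu
    simp only [ContinuousLinearMap.comp_apply, hBA w hw] at this
    exact congrArg Prod.fst this
  have hinjN : ∀ w ∈ W₀, Function.Injective (ν₀ w) := by
    intro w hw
    rw [injective_iff_map_eq_zero]
    intro t ht
    have h1 : ⟪ν₀ w t, fderiv ℝ φ.symm (w, 0) (0, t)⟫ = 0 := by rw [ht, inner_zero_left]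
    rw [hν₀, ContinuousLinearMap.adjoint_inner_left, fderiv_snd_comp hφ (hsrc w hw),
      ContinuousLinearMap.comp_apply, hBA w hw] at h1
    exact inner_self_eq_zero.1 h1
  have horth : ∀ w ∈ W₀, ∀ u t, ⟪fderiv ℝ ψ₀ w u, ν₀ w t⟫ = 0 := by
    intro w hw u t
    rw [hν₀, ContinuousLinearMap.adjoint_inner_right, fderiv_snd_comp hφ (hsrc w hw), hD w hw,
      ContinuousLinearMap.comp_apply, ContinuousLinearMap.comp_apply, hBA w hw]
    simp
  have hψC : ContDiffOn ℝ 2 ψ₀ W₀ :=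
    hφ'.comp (t := φ.target) (f := fun w : EucSp d => (w, (0 : EucSp (D - d))))
      (by fun_prop) (fun w hw => hw)
  have hνC : ContDiffOn ℝ 1 ν₀ W₀ := by
    have h1 : ContDiffOn ℝ 1 (fderiv ℝ (fun y => (φ y).2)) φ.source :=
      (contDiff_snd.comp_contDiffOn hφ).fderiv_of_isOpen φ.open_source (by norm_num)
    exact isBoundedLinearMap_adjoint.contDiff.comp_contDiffOn
      (h1.comp (hψC.of_le (by norm_num)) hsrc)
  obtain ⟨L, JT, hL⟩ := exists_comp_eq_linearIsometry (fderiv ℝ ψ₀ w₀) (hinjD w₀ hw₀W)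
  obtain ⟨L', JN, hL'⟩ := exists_comp_eq_linearIsometry (ν₀ w₀) (hinjN w₀ hw₀W)
  set T : EucSp d → EucSp d := fun w => w₀ + L w with hT
  have hTc : ContDiff ℝ 2 T := by fun_prop
  have hT0 : T 0 = w₀ := by simp [hT]
  have hTinj : Function.Injective T := fun a b h => L.injective (by simpa [hT] using h)
  have hTopen : IsOpenMap T := (isOpenMap_add_left w₀).comp L.toHomeomorph.isOpenMap
  have hDT : ∀ w ∈ T ⁻¹' W₀, fderiv ℝ (ψ₀ ∘ T) w = (fderiv ℝ ψ₀ (T w)).comp (L : EucSp d →L[ℝ] EucSp d) := by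
    intro w hw
    have h1 : HasFDerivAt ψ₀ (fderiv ℝ ψ₀ (T w)) (T w) :=
      ((hψC.contDiffAt (hW₀o.mem_nhds hw)).differentiableAt (by norm_num)).hasFDerivAt
    have h2 : HasFDerivAt T (L : EucSp d →L[ℝ] EucSp d) w := by
      simpa [hT] using (L.hasFDerivAt (x := w)).const_add w₀
    exact (h1.comp w h2).fderiv
  refine ⟨{
    ψ := ψ₀ ∘ T
    ν := fun w => (ν₀ (T w)).comp (L' : EucSp (D - d) →L[ℝ] EucSp (D - d))
    W := T ⁻¹' W₀
    JT := JT
    JN := JN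
    isOpen_W := hW₀o.preimage hTc.continuous
    zero_mem := by rw [mem_preimage, hT0]; exact hw₀W
    ψ_zero := by
      rw [Function.comp_apply, hT0, hψ₀]
      change φ.symm (w₀, 0) = p
      rw [← hφp, φ.left_inv hpφ]
    exists_image_eq := ?_
    injOn := ?_
    contDiffOn_ψ := hψC.comp hTc.contDiffOn fun w hw => hw
    contDiffOn_ν := (hνC.comp (hTc.of_le (by norm_num)).contDiffOn fun w hw => hw).clm_comp
      contDiffOn_const
    fderiv_ψ_zero := ?_
    ν_zero := by
      ext1 t
      simp [hT0, hL']
    injective_fderiv := fun w hw => by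
      rw [hDT w hw]; exact (hinjD _ hw).comp L.injective
    injective_ν := fun w hw => (hinjN _ hw).comp L'.injective
    inner_eq_zero := fun w hw u t => by
      rw [hDT w hw]; exact horth _ hw _ _
    isProximalNormal := fun w hw t =>
      isProximalNormal_adjoint_fderiv hφ hM (hsrc _ hw) (hψM _ hw) _ }⟩
  · intro V hV hVo
    refine ⟨φ.source ∩ φ ⁻¹' ((T '' V) ×ˢ univ),
      φ.continuousOn.isOpen_inter_preimage φ.open_source ((hTopen V hVo).prod isOpen_univ), ?_⟩
    ext x
    constructor
    · rintro ⟨w, hw, rfl⟩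
      refine ⟨hψM _ (hV hw), hsrc _ (hV hw), ?_⟩
      rw [mem_preimage, Function.comp_apply, hφψ _ (hV hw)]
      exact ⟨mem_image_of_mem T hw, mem_univ _⟩
    · rintro ⟨hxM, hxs, ⟨w, hw, hwx⟩, -⟩
      refine ⟨w, hw, ?_⟩
      have : φ x = (T w, 0) := Prod.ext hwx.symm ((hM x hxs).1 hxM)
      change φ.symm (T w, 0) = x
      rw [← this, φ.left_inv hxs]
  · intro w hw w' hw' h
    have := congrArg φ h
    simp only [Function.comp_apply] at this
    rw [hφψ _ hw, hφψ _ hw'] at this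
    exact hTinj (congrArg Prod.fst this)
  · rw [hDT 0 (by rw [mem_preimage, hT0]; exact hw₀W), hT0]
    ext1 u
    simp [hL]

end Param

/-! ### Determinant and operator norm bounds. -/

section Det

variable {k : ℕ}

/-- The absolute determinant is the volume ratio of the image of the unit ball, and that image lies
in the ball of radius `c`. -/
theorem abs_det_le_pow (A : EucSp k →L[ℝ] EucSp k) {c : ℝ} (hc : 0 ≤ c)
    (h : ∀ x, ‖A x‖ ≤ c * ‖x‖) : |A.det| ≤ c ^ k := by
  have h1 := Measure.addHaar_image_continuousLinearMap volume A (closedBall 0 1)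
  have h2 : A '' closedBall 0 1 ⊆ closedBall 0 c := by
    rintro _ ⟨x, hx, rfl⟩
    rw [mem_closedBall_zero_iff] at hx ⊢
    exact (h x).trans (by nlinarith)
  have h3 := measure_mono (μ := volume) h2
  rw [h1, Measure.addHaar_closedBall' volume (0 : EucSp k) hc, finrank_euclideanSpace_fin] at h3
  have h4 : volume (closedBall (0 : EucSp k) 1) ≠ 0 :=
    (measure_closedBall_pos volume _ one_pos).ne'
  have h5 : volume (closedBall (0 : EucSp k) 1) ≠ ⊤ := measure_closedBall_lt_top.ne
  exact (ENNReal.ofReal_le_ofReal_iff (by positivity)).1 ((ENNReal.mul_le_mul_iff_left h4 h5).1 h3)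

theorem pow_le_abs_det (A : EucSp k →L[ℝ] EucSp k) {c : ℝ} (hc : 0 < c)
    (h : ∀ x, c * ‖x‖ ≤ ‖A x‖) : c ^ k ≤ |A.det| := by
  have hinj : Function.Injective A := by
    rw [injective_iff_map_eq_zero]
    intro x hx
    have := h x
    rw [hx, norm_zero] at this
    exact norm_eq_zero.1 (le_antisymm (by nlinarith) (norm_nonneg x))
  have hsurj : Function.Surjective A := (LinearMap.injective_iff_surjective (f := A.toLinearMap)).1 hinj
  have h1 := Measure.addHaar_image_continuousLinearMap volume A (closedBall 0 1)
  have h2 : closedBall 0 c ⊆ A '' closedBall 0 1 := by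
    intro y hy
    obtain ⟨x, rfl⟩ := hsurj y
    refine ⟨x, ?_, rfl⟩
    rw [mem_closedBall_zero_iff] at hy ⊢
    exact le_of_mul_le_mul_left (by linarith [h x]) hc
  have h3 := measure_mono (μ := volume) h2
  rw [h1, Measure.addHaar_closedBall' volume (0 : EucSp k) hc.le,
    finrank_euclideanSpace_fin] at h3
  have h4 : volume (closedBall (0 : EucSp k) 1) ≠ 0 :=
    (measure_closedBall_pos volume _ one_pos).ne'
  have h5 : volume (closedBall (0 : EucSp k) 1) ≠ ⊤ := measure_closedBall_lt_top.ne
  exact (ENNReal.ofReal_le_ofReal_iff (by positivity)).1 ((ENNReal.mul_le_mul_iff_left h4 h5).1 h3)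

/-- A symmetric operator is bounded by its numerical radius. -/
theorem norm_apply_le_of_abs_inner_self_le {E : Type*} [NormedAddCommGroup E]
    [InnerProductSpace ℝ E] (S : E →L[ℝ] E) (hS : ∀ x y, ⟪x, S y⟫ = ⟪y, S x⟫) {c : ℝ} (hc : 0 ≤ c)
    (h : ∀ x, |⟪x, S x⟫| ≤ c * ‖x‖ ^ 2) (x : E) : ‖S x‖ ≤ c * ‖x‖ := by
  have key : ∀ x y : E, 2 * ⟪y, S x⟫ ≤ c * (‖x‖ ^ 2 + ‖y‖ ^ 2) := by
    intro x y
    have h1 := (abs_le.1 (h (x + y))).2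
    have h2 := (abs_le.1 (h (x - y))).1
    have h3 := parallelogram_law_with_norm ℝ x y
    simp only [map_add, map_sub, inner_add_left, inner_add_right, inner_sub_left,
      inner_sub_right, hS x y] at h1 h2
    nlinarith
  rcases (norm_nonneg (S x)).eq_or_lt with h0 | h0
  · rw [← h0]; positivity
  rcases (norm_nonneg x).eq_or_lt with hx | hx
  · rw [norm_eq_zero.1 hx.symm]; simp
  have h1 := key x ((‖x‖ / ‖S x‖) • S x)
  rw [real_inner_smul_left, real_inner_self_eq_norm_sq, norm_smul, Real.norm_eq_abs,
    abs_of_pos (by positivity), div_mul_cancel₀ _ h0.ne'] at h1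
  have h2 : ‖x‖ / ‖S x‖ * ‖S x‖ ^ 2 = ‖x‖ * ‖S x‖ := by field_simp
  rw [h2] at h1
  exact le_of_mul_le_mul_left (by nlinarith) hx

/-- The determinant of a block triangular map. -/
theorem det_prod_comp_fst_add_snd {E F : Type*} [AddCommGroup E] [Module ℝ E]
    [FiniteDimensional ℝ E] [AddCommGroup F] [Module ℝ F] [FiniteDimensional ℝ F]
    (A : E →ₗ[ℝ] E) (C : E →ₗ[ℝ] F) :
    LinearMap.det ((A ∘ₗ LinearMap.fst ℝ E F).prod
      (C ∘ₗ LinearMap.fst ℝ E F + LinearMap.snd ℝ E F)) = LinearMap.det A := by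
  let b := Module.Free.chooseBasis ℝ E
  let b' := Module.Free.chooseBasis ℝ F
  rw [← LinearMap.det_toMatrix (b.prod b'), ← LinearMap.det_toMatrix b]
  have : LinearMap.toMatrix (b.prod b') (b.prod b') ((A ∘ₗ LinearMap.fst ℝ E F).prod
      (C ∘ₗ LinearMap.fst ℝ E F + LinearMap.snd ℝ E F)) =
      Matrix.fromBlocks (LinearMap.toMatrix b b A) 0 (LinearMap.toMatrix b b' C) 1 := by
    ext (i | i) (j | j) <;> simp [LinearMap.toMatrix_apply, Matrix.one_apply, Finsupp.single_apply,
      eq_comm]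
  rw [this, Matrix.det_fromBlocks_zero₁₂, Matrix.det_one, mul_one]

end Det

/-! ### The normal space and the shape operator. -/

namespace NormalParam

variable {D d : ℕ} {M : Set (EucSp D)} {p : EucSp D} (N : NormalParam d M p)

theorem ψ_mem {w : EucSp d} (hw : w ∈ N.W) : N.ψ w ∈ M := (N.isProximalNormal w hw 0).mem

theorem mem_nhds {w : EucSp d} (hw : w ∈ N.W) : N.W ∈ 𝓝 w := N.isOpen_W.mem_nhds hw

theorem contDiffAt_ψ {w : EucSp d} (hw : w ∈ N.W) : ContDiffAt ℝ 2 N.ψ w :=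
  N.contDiffOn_ψ.contDiffAt (N.mem_nhds hw)

theorem contDiffAt_ν {w : EucSp d} (hw : w ∈ N.W) : ContDiffAt ℝ 1 N.ν w :=
  N.contDiffOn_ν.contDiffAt (N.mem_nhds hw)

theorem hasFDerivAt_ψ {w : EucSp d} (hw : w ∈ N.W) : HasFDerivAt N.ψ (fderiv ℝ N.ψ w) w :=
  ((N.contDiffAt_ψ hw).differentiableAt (by norm_num)).hasFDerivAt

theorem hasFDerivAt_ν {w : EucSp d} (hw : w ∈ N.W) : HasFDerivAt N.ν (fderiv ℝ N.ν w) w :=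
  ((N.contDiffAt_ν hw).differentiableAt (by norm_num)).hasFDerivAt

theorem hasFDerivAt_ψ_zero : HasFDerivAt N.ψ N.JT.toContinuousLinearMap 0 := by
  rw [← N.fderiv_ψ_zero]; exact N.hasFDerivAt_ψ N.zero_mem

theorem hasFDerivAt_fderiv_ψ : HasFDerivAt (fderiv ℝ N.ψ) (fderiv ℝ (fderiv ℝ N.ψ) 0) 0 :=
  (((N.contDiffAt_ψ N.zero_mem).fderiv_right (m := 1) (by norm_num)).differentiableAt
    (by norm_num)).hasFDerivAt

theorem ν_zero_apply (t : EucSp (D - d)) : N.ν 0 t = N.JN t := by rw [N.ν_zero]; rfl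

theorem inner_JT_JN (u : EucSp d) (t : EucSp (D - d)) : ⟪N.JT u, N.JN t⟫ = 0 := by
  have := N.inner_eq_zero 0 N.zero_mem u t
  rwa [N.fderiv_ψ_zero, N.ν_zero_apply] at this

/-- The range of the frame lies in the orthogonal complement of the tangent space and has the same
dimension. -/
theorem exists_ν_eq (hdD : d ≤ D) {w : EucSp d} (hw : w ∈ N.W) {v : EucSp D}
    (hv : ∀ u, ⟪fderiv ℝ N.ψ w u, v⟫ = 0) : ∃ t, N.ν w t = v := by
  set K := LinearMap.range (fderiv ℝ N.ψ w).toLinearMap with hK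
  set K' := LinearMap.range (N.ν w).toLinearMap with hK'
  have h1 : Module.finrank ℝ K = d := by
    rw [hK, LinearMap.finrank_range_of_inj (N.injective_fderiv w hw), finrank_euclideanSpace_fin]
  have h2 : Module.finrank ℝ K' = D - d := by
    rw [hK', LinearMap.finrank_range_of_inj (N.injective_ν w hw), finrank_euclideanSpace_fin]
  have h3 := K.finrank_add_finrank_orthogonal
  rw [finrank_euclideanSpace_fin] at h3
  have h4 : K' ≤ Kᗮ := by
    rintro _ ⟨t, rfl⟩ 
    rw [Submodule.mem_orthogonal]
    rintro _ ⟨u, rfl⟩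
    exact N.inner_eq_zero w hw u t
  have h5 : K' = Kᗮ := Submodule.eq_of_le_of_finrank_eq h4 (by omega)
  have h6 : v ∈ Kᗮ := by
    rw [Submodule.mem_orthogonal]
    rintro _ ⟨u, rfl⟩
    exact hv u
  rw [← h5] at h6
  exact h6

/-- First-order condition: `w` minimises the squared distance from `z`, so `z - N.ψ w` is orthogonal
to the tangent space. -/
theorem exists_eq_add_ν (hdD : d ≤ D) {w : EucSp d} (hw : w ∈ N.W) {z : EucSp D}
    (hz : IsNearestPoint M z (N.ψ w)) : ∃ t, z = N.ψ w + N.ν w t := by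
  have hmin : IsLocalMin (fun w' => ‖z - N.ψ w'‖ ^ 2) w := by
    filter_upwards [N.mem_nhds hw] with w' hw'
    have h1 : ‖z - N.ψ w‖ ≤ ‖z - N.ψ w'‖ := by
      rw [← dist_eq_norm, ← dist_eq_norm, dist_comm, hz.2]
      exact infDist_le_dist_of_mem (N.ψ_mem hw')
    gcongr
  have hd := ((N.hasFDerivAt_ψ hw).const_sub z).norm_sq
  have h0 := hmin.hasFDerivAt_eq_zero hd
  obtain ⟨t, ht⟩ := N.exists_ν_eq hdD hw (v := z - N.ψ w) fun u => by
    have := DFunLike.congr_fun h0 u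
    rw [real_inner_comm, inner_sub_left]
    simp at this
    linarith
  exact ⟨t, by rw [ht]; abel⟩

/-- The shape operator at `p` in the normal direction `t`. -/
noncomputable def shape (t : EucSp (D - d)) : EucSp d →L[ℝ] EucSp d :=
  (ContinuousLinearMap.adjoint N.JT.toContinuousLinearMap).comp
    ((ContinuousLinearMap.apply ℝ (EucSp D) t).comp (fderiv ℝ N.ν 0))

theorem inner_shape (t : EucSp (D - d)) (ξ w : EucSp d) :
    ⟪ξ, N.shape t w⟫ = ⟪N.JT ξ, fderiv ℝ N.ν 0 w t⟫ := by
  simp [shape, ContinuousLinearMap.adjoint_inner_right]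

/-- Differentiate the identity `⟪fderiv ℝ N.ψ w ξ, N.ν w t⟫ = 0` at `w = 0`. Symmetry of the shape
operator then follows from that of the second derivative. -/
theorem inner_shape_eq_neg (t : EucSp (D - d)) (ξ w : EucSp d) :
    ⟪ξ, N.shape t w⟫ = -⟪fderiv ℝ (fderiv ℝ N.ψ) 0 w ξ, N.JN t⟫ := by
  rw [inner_shape]
  have h1 : HasFDerivAt (fun w => fderiv ℝ N.ψ w ξ)
      ((fderiv ℝ (fderiv ℝ N.ψ) 0).flip ξ) 0 := by
    simpa using N.hasFDerivAt_fderiv_ψ.clm_apply (hasFDerivAt_const ξ 0)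
  have h2 : HasFDerivAt (fun w => N.ν w t) ((fderiv ℝ N.ν 0).flip t) 0 := by
    simpa using (N.hasFDerivAt_ν N.zero_mem).clm_apply (hasFDerivAt_const t 0)
  have h3 := h1.inner ℝ h2
  have h4 : (fun w => ⟪fderiv ℝ N.ψ w ξ, N.ν w t⟫) =ᶠ[𝓝 0] fun _ => (0 : ℝ) := by
    filter_upwards [N.mem_nhds N.zero_mem] with w hw using N.inner_eq_zero w hw ξ t
  have h5 := DFunLike.congr_fun (h3.unique ((hasFDerivAt_const (0 : ℝ) 0).congr_of_eventuallyEq h4)) w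
  simp only [fderiv_ψ_zero, ν_zero] at h5
  simp at h5
  linarith

theorem inner_shape_comm (t : EucSp (D - d)) (ξ w : EucSp d) :
    ⟪ξ, N.shape t w⟫ = ⟪w, N.shape t ξ⟫ := by
  have h : IsSymmSndFDerivAt ℝ N.ψ 0 :=
    (N.contDiffAt_ψ N.zero_mem).isSymmSndFDerivAt (by simp)
  rw [inner_shape_eq_neg, inner_shape_eq_neg, h.eq]

section

variable {τ : ℝ} (hM : IsCompact M) (H : thickening τ M ⊆ uniqueNearestSet M) (hτ : 0 < τ)

include hM H hτ

/-- Federer's inequality is used at `p` for the chord to `N.ψ (s • u)` and at `N.ψ (s • u)` for the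
reverse chord. Their sum involves the increments of `ψ` and `ν`; dividing by `s ^ 2` and letting `s`
tend to `0` gives the bound on the shape operator. -/
theorem neg_inner_shape_self_le (t : EucSp (D - d)) (u : EucSp d) :
    -⟪u, N.shape t u⟫ ≤ ‖t‖ / τ * ‖u‖ ^ 2 := by
  have hline : HasDerivAt (fun s : ℝ => s • u) u 0 := by
    simpa using (hasDerivAt_id (0 : ℝ)).smul_const u
  have hψ : HasDerivAt (fun s : ℝ => N.ψ (s • u)) (N.JT u) 0 :=
    HasFDerivAt.comp_hasDerivAt (l := N.ψ) (l' := N.JT.toContinuousLinearMap) 0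
      (by simp only [zero_smul]; exact N.hasFDerivAt_ψ_zero) hline
  have hν : HasDerivAt (fun s : ℝ => N.ν (s • u) t) (fderiv ℝ N.ν 0 u t) 0 := by
    have h1 : HasDerivAt (fun s : ℝ => N.ν (s • u)) (fderiv ℝ N.ν 0 u) 0 :=
      HasFDerivAt.comp_hasDerivAt (l := N.ν) (l' := fderiv ℝ N.ν 0) 0
        (by simp only [zero_smul]; exact N.hasFDerivAt_ν N.zero_mem) hline
    simpa using h1.clm_apply (hasDerivAt_const (0 : ℝ) t)
  have hx := hψ.tendsto_slope_zero_right
  have hy := hν.tendsto_slope_zero_right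
  have hν0 : Tendsto (fun s : ℝ => ‖N.ν (s • u) t‖) (𝓝[>] 0) (𝓝 ‖t‖) := by
    have h1 := hν.continuousAt.norm.tendsto
    simp only [zero_smul, ν_zero_apply, LinearIsometry.norm_map] at h1
    exact h1.mono_left nhdsWithin_le_nhds
  simp only [zero_add, zero_smul, N.ψ_zero, N.ν_zero_apply] at hx hy
  have hl := (hx.inner (𝕜 := ℝ) hy).neg
  have hr := ((hν0.const_add ‖t‖).mul (hx.norm.pow 2)).div_const (2 * τ)
  rw [LinearIsometry.norm_map, ← inner_shape] at *
  have hrv : (‖t‖ + ‖t‖) * ‖u‖ ^ 2 / (2 * τ) = ‖t‖ / τ * ‖u‖ ^ 2 := by field_simp; ring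
  rw [hrv] at hr
  refine le_of_tendsto_of_tendsto hl hr ?_
  have hW : ∀ᶠ s : ℝ in 𝓝[>] 0, s • u ∈ N.W := by
    refine nhdsWithin_le_nhds (hline.continuousAt.preimage_mem_nhds ?_)
    simp only [zero_smul]; exact N.mem_nhds N.zero_mem
  filter_upwards [hW, self_mem_nhdsWithin] with s hs hs0
  have hs0' : (0 : ℝ) < s := hs0
  have h1 := (N.isProximalNormal _ hs t).inner_le hM H hτ (N.ψ_mem N.zero_mem)
  have h2 := (N.isProximalNormal 0 N.zero_mem t).inner_le hM H hτ (N.ψ_mem hs)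
  rw [N.ψ_zero] at h1 h2
  rw [N.ν_zero_apply, LinearIsometry.norm_map] at h2
  rw [norm_sub_rev] at h1
  simp only [real_inner_smul_left, real_inner_smul_right, norm_smul, norm_inv, Real.norm_eq_abs,
    abs_of_pos hs0', mul_pow]
  rw [← mul_le_mul_iff_right₀ (show 0 < s ^ 2 by positivity)]
  have h3 : ⟪N.ψ (s • u) - p, N.ν (s • u) t - N.JN t⟫ =
      -⟪p - N.ψ (s • u), N.ν (s • u) t⟫ - ⟪N.ψ (s • u) - p, N.JN t⟫ := by
    rw [inner_sub_right, ← inner_neg_left, neg_sub]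
  have h4 : s ^ 2 * -(s⁻¹ * (s⁻¹ * ⟪N.ψ (s • u) - p, N.ν (s • u) t - N.JN t⟫)) =
      ⟪p - N.ψ (s • u), N.ν (s • u) t⟫ + ⟪N.ψ (s • u) - p, N.JN t⟫ := by
    rw [h3]; field_simp; ring
  have h5 : s ^ 2 * ((‖t‖ + ‖N.ν (s • u) t‖) * (s⁻¹ ^ 2 * ‖N.ψ (s • u) - p‖ ^ 2) / (2 * τ)) =
      ‖N.ν (s • u) t‖ * ‖N.ψ (s • u) - p‖ ^ 2 / (2 * τ) +
        ‖t‖ * ‖N.ψ (s • u) - p‖ ^ 2 / (2 * τ) := by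
    field_simp; ring
  rw [h4, h5]
  linarith

theorem norm_shape_apply_le (t : EucSp (D - d)) (u : EucSp d) :
    ‖N.shape t u‖ ≤ ‖t‖ / τ * ‖u‖ := by
  refine norm_apply_le_of_abs_inner_self_le _ (N.inner_shape_comm t) (by positivity)
    (fun x => abs_le.2 ⟨?_, ?_⟩) u
  · linarith [N.neg_inner_shape_self_le hM H hτ t x]
  · have h := N.neg_inner_shape_self_le hM H hτ (-t) x
    rw [inner_shape, map_neg, inner_neg_right, neg_neg, norm_neg, ← inner_shape] at h
    exact h

/-- To first order, the tangential part at `p` of a nearby normal vector is given by the shape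
operator; `c - 1 / τ` absorbs the remainder. This and its tangent counterpart below measure the
angle between nearby normal spaces. -/
theorem eventually_abs_inner_JT_ν_le {c : ℝ} (hc : 1 / τ < c) :
    ∀ᶠ w in 𝓝 (0 : EucSp d), ∀ ξ t, |⟪N.JT ξ, N.ν w t⟫| ≤ c * ‖w‖ * ‖ξ‖ * ‖t‖ := by
  have h := (hasFDerivAt_iff_isLittleO_nhds_zero.1 (N.hasFDerivAt_ν N.zero_mem)).def
    (show 0 < c - 1 / τ by linarith)
  filter_upwards [h] with w hw ξ t
  rw [zero_add] at hw
  have h1 : ⟪N.JT ξ, N.ν w t⟫ = ⟪N.JT ξ, (N.ν w - N.ν 0 - fderiv ℝ N.ν 0 w) t⟫ +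
      ⟪ξ, N.shape t w⟫ := by
    rw [inner_shape]
    simp [inner_sub_right, N.ν_zero_apply, N.inner_JT_JN]
  have h2 : |⟪N.JT ξ, (N.ν w - N.ν 0 - fderiv ℝ N.ν 0 w) t⟫| ≤
      ‖ξ‖ * ((c - 1 / τ) * ‖w‖ * ‖t‖) := by
    refine (abs_real_inner_le_norm _ _).trans ?_
    rw [LinearIsometry.norm_map]
    gcongr
    exact (ContinuousLinearMap.le_opNorm _ _).trans (by gcongr)
  have h3 : |⟪ξ, N.shape t w⟫| ≤ ‖ξ‖ * (‖t‖ / τ * ‖w‖) :=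
    (abs_real_inner_le_norm _ _).trans (by gcongr; exact N.norm_shape_apply_le hM H hτ t w)
  rw [h1]
  refine (abs_add_le _ _).trans ((add_le_add h2 h3).trans (le_of_eq ?_))
  field_simp; ring

theorem eventually_abs_inner_fderiv_JN_le {c : ℝ} (hc : 1 / τ < c) :
    ∀ᶠ w in 𝓝 (0 : EucSp d), ∀ ξ t, |⟪fderiv ℝ N.ψ w ξ, N.JN t⟫| ≤ c * ‖w‖ * ‖ξ‖ * ‖t‖ := by
  have h := (hasFDerivAt_iff_isLittleO_nhds_zero.1 N.hasFDerivAt_fderiv_ψ).def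
    (show 0 < c - 1 / τ by linarith)
  filter_upwards [h] with w hw ξ t
  rw [zero_add] at hw
  have h1 : ⟪fderiv ℝ N.ψ w ξ, N.JN t⟫ =
      ⟪(fderiv ℝ N.ψ w - fderiv ℝ N.ψ 0 - fderiv ℝ (fderiv ℝ N.ψ) 0 w) ξ, N.JN t⟫ -
      ⟪ξ, N.shape t w⟫ := by
    rw [inner_shape_eq_neg]
    simp [inner_sub_left, N.fderiv_ψ_zero, N.inner_JT_JN]
  have h2 : |⟪(fderiv ℝ N.ψ w - fderiv ℝ N.ψ 0 - fderiv ℝ (fderiv ℝ N.ψ) 0 w) ξ, N.JN t⟫| ≤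
      ((c - 1 / τ) * ‖w‖ * ‖ξ‖) * ‖t‖ := by
    refine (abs_real_inner_le_norm _ _).trans ?_
    rw [LinearIsometry.norm_map]
    gcongr
    exact (ContinuousLinearMap.le_opNorm _ _).trans (by gcongr)
  have h3 : |⟪ξ, N.shape t w⟫| ≤ ‖ξ‖ * (‖t‖ / τ * ‖w‖) :=
    (abs_real_inner_le_norm _ _).trans (by gcongr; exact N.norm_shape_apply_le hM H hτ t w)
  rw [h1]
  refine (abs_sub _ _).trans ((add_le_add h2 h3).trans (le_of_eq ?_))
  field_simp; ring

end

end NormalParam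

/-! ### Hausdorff measure and nearly isometric maps. -/

theorem LipschitzOnWith.euclideanHausdorffMeasure_image_le {X Y : Type*} [EMetricSpace X]
    [EMetricSpace Y] [MeasurableSpace X] [BorelSpace X] [MeasurableSpace Y] [BorelSpace Y]
    {K : ℝ≥0} {f : X → Y} {s : Set X} (h : LipschitzOnWith K f s) (d : ℕ) :
    (μHE[d] : Measure Y) (f '' s) ≤ (K : ℝ≥0∞) ^ d * (μHE[d] : Measure X) s := by
  have h1 := h.hausdorffMeasure_image_le (d := d) (Nat.cast_nonneg d)
  rw [ENNReal.rpow_natCast] at h1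
  simp only [Measure.euclideanHausdorffMeasure_def, Measure.smul_apply, ENNReal.smul_def,
    smul_eq_mul]
  calc _ ≤ _ := mul_le_mul_right h1 _
    _ = _ := by ring

/-- The image of a set on which `f` is expanding up to the factor `K⁻¹`. -/
theorem euclideanHausdorffMeasure_le_of_edist_le {X Y : Type*} [EMetricSpace X]
    [EMetricSpace Y] [MeasurableSpace X] [BorelSpace X] [MeasurableSpace Y] [BorelSpace Y]
    {K : ℝ≥0} {f : X → Y} {s : Set X} (h : ∀ x ∈ s, ∀ y ∈ s, edist x y ≤ K * edist (f x) (f y))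
    (d : ℕ) : (μHE[d] : Measure X) s ≤ (K : ℝ≥0∞) ^ d * (μHE[d] : Measure Y) (f '' s) := by
  rcases s.eq_empty_or_nonempty with rfl | ⟨x₀, -⟩
  · simp
  have : Nonempty X := ⟨x₀⟩
  have hinj : InjOn f s := fun x hx y hy hxy => by
    have := h x hx y hy
    rw [hxy, edist_self, mul_zero] at this
    exact edist_le_zero.1 this
  have hg : LipschitzOnWith K (Function.invFunOn f s) (f '' s) := by
    rintro _ ⟨x, hx, rfl⟩ _ ⟨y, hy, rfl⟩
    rw [hinj.leftInvOn_invFunOn hx, hinj.leftInvOn_invFunOn hy]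
    exact h x hx y hy
  have h1 := hg.euclideanHausdorffMeasure_image_le d
  rwa [hinj.leftInvOn_invFunOn.image_image] at h1

theorem norm_le_mul_of_norm_sub_le {F G : Type*} [NormedAddCommGroup F] [NormedAddCommGroup G]
    {x : F} {y z : G} {K : ℝ} (hK : 1 < K) (hxz : ‖z‖ = ‖x‖) (h : ‖y - z‖ ≤ (1 - 1 / K) * ‖x‖) :
    ‖y‖ ≤ K * ‖x‖ ∧ ‖x‖ ≤ K * ‖y‖ := by
  have h2 := norm_sub_norm_le y z
  have h3 := norm_sub_norm_le z y
  rw [norm_sub_rev z] at h3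
  have hd := norm_nonneg x
  have hK0 : 0 < K := by linarith
  -- The error `1 - 1 / K` makes the lower bound exactly `1 / K`; the upper bound `2 - 1 / K` is at
  -- most `K` since `K + 1 / K ≥ 2`.
  have h5 : 2 - 1 / K ≤ K := by
    rw [sub_le_iff_le_add, ← sub_le_iff_le_add', le_div_iff₀ hK0]; nlinarith [sq_nonneg (K - 1)]
  constructor
  · nlinarith
  · have h4 : 1 / K * ‖x‖ ≤ ‖y‖ := by linarith
    have := mul_le_mul_of_nonneg_left h4 hK0.le
    rwa [← mul_assoc, mul_one_div, div_self hK0.ne', one_mul] at this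

theorem ContinuousAt.eventually_norm_apply_le {X F G : Type*} [TopologicalSpace X]
    [NormedAddCommGroup F] [NormedSpace ℝ F] [NormedAddCommGroup G] [NormedSpace ℝ G]
    {A : X → F →L[ℝ] G} {x₀ : X} (hA : ContinuousAt A x₀) {J : F →ₗᵢ[ℝ] G}
    (hJ : A x₀ = J.toContinuousLinearMap) {K : ℝ} (hK : 1 < K) :
    ∀ᶠ x in 𝓝 x₀, ∀ u, ‖A x u‖ ≤ K * ‖u‖ ∧ ‖u‖ ≤ K * ‖A x u‖ := by
  have hη : 0 < 1 - 1 / K := by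
    rw [sub_pos, div_lt_one (by linarith)]; exact hK
  filter_upwards [hA.eventually (ball_mem_nhds _ hη)] with x hx u
  rw [dist_eq_norm, hJ] at hx
  exact norm_le_mul_of_norm_sub_le hK (J.norm_map u)
    (((A x - J.toContinuousLinearMap).le_opNorm u).trans (by gcongr))

/-! ### The tube map and its Jacobian. -/

namespace NormalParam

variable {D d : ℕ} {M : Set (EucSp D)} {p : EucSp D} (N : NormalParam d M p)

theorem norm_sq_JT_add_JN (u : EucSp d) (s : EucSp (D - d)) :
    ‖N.JT u + N.JN s‖ ^ 2 = ‖u‖ ^ 2 + ‖s‖ ^ 2 := by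
  rw [norm_add_sq_real, N.inner_JT_JN]; simp

/-- The product type carries the sup norm, so the isometry is built on the `L²` product and
transported; the passage between the two preserves volume. -/
theorem exists_prod_equiv (hdD : d ≤ D) :
    ∃ e : (EucSp d × EucSp (D - d)) ≃L[ℝ] EucSp D,
      (∀ z, e z = N.JT z.1 + N.JN z.2) ∧ ∀ s, volume (e '' s) = volume s := by
  let l : WithLp 2 (EucSp d × EucSp (D - d)) →ₗᵢ[ℝ] EucSp D :=
    { toLinearMap := (N.JT.toLinearMap ∘ₗ LinearMap.fst ℝ _ _ +
        N.JN.toLinearMap ∘ₗ LinearMap.snd ℝ _ _) ∘ₗ (WithLp.linearEquiv 2 ℝ _).toLinearMap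
      norm_map' := fun z => by
        rw [← sq_eq_sq₀ (norm_nonneg _) (norm_nonneg _), WithLp.prod_norm_sq_eq_of_L2]
        exact N.norm_sq_JT_add_JN _ _ }
  have hfr : Module.finrank ℝ (WithLp 2 (EucSp d × EucSp (D - d))) =
      Module.finrank ℝ (EucSp D) := by
    rw [(WithLp.linearEquiv 2 ℝ (EucSp d × EucSp (D - d))).finrank_eq, Module.finrank_prod]
    simp only [finrank_euclideanSpace_fin]
    omega
  let L := l.toLinearIsometryEquiv hfr
  refine ⟨(WithLp.prodContinuousLinearEquiv 2 ℝ _ _).symm.trans L.toContinuousLinearEquiv,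
    fun z => rfl, fun s => ?_⟩
  have h1 := L.measurePreserving
  have h2 := WithLp.volume_preserving_toLp (EucSp d) (EucSp (D - d))
  have h3 := h1.comp h2
  have h4 : MeasurableEmbedding (L ∘ @WithLp.toLp 2 (EucSp d × EucSp (D - d))) :=
    (((WithLp.prodContinuousLinearEquiv 2 ℝ _ _).symm.trans
      L.toContinuousLinearEquiv).toHomeomorph).measurableEmbedding
  have h5 : volume s = volume ((L ∘ @WithLp.toLp 2 (EucSp d × EucSp (D - d))) ⁻¹'
      ((L ∘ @WithLp.toLp 2 (EucSp d × EucSp (D - d))) '' s)) := by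
    rw [h4.injective.preimage_image]
  rw [h5, h3.measure_preimage_emb h4]
  rfl

/-- The tube map `(w, t) ↦ ψ w + ν w t`. -/
def tubeMap (z : EucSp d × EucSp (D - d)) : EucSp D := N.ψ z.1 + N.ν z.1 z.2

/-- The derivative of the tube map. -/
noncomputable def tubeMapDeriv (z : EucSp d × EucSp (D - d)) :
    (EucSp d × EucSp (D - d)) →L[ℝ] EucSp D :=
  (fderiv ℝ N.ψ z.1 + (fderiv ℝ N.ν z.1).flip z.2).comp (ContinuousLinearMap.fst ℝ _ _) +
    (N.ν z.1).comp (ContinuousLinearMap.snd ℝ _ _)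

theorem hasFDerivAt_tubeMap {z : EucSp d × EucSp (D - d)} (hz : z.1 ∈ N.W) :
    HasFDerivAt N.tubeMap (N.tubeMapDeriv z) z := by
  have h1 := (N.hasFDerivAt_ψ hz).comp z hasFDerivAt_fst
  have h2 := ((N.hasFDerivAt_ν hz).comp z hasFDerivAt_fst).clm_apply
    (hasFDerivAt_snd (𝕜 := ℝ) (p := z))
  refine (h1.add h2).congr_fderiv (ContinuousLinearMap.ext fun x => ?_)
  simp [tubeMapDeriv]
  abel

theorem continuousOn_tubeMapDeriv : ContinuousOn N.tubeMapDeriv (N.W ×ˢ univ) := by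
  have h1 : ContinuousOn (fun z : EucSp d × EucSp (D - d) => fderiv ℝ N.ψ z.1) (N.W ×ˢ univ) :=
    (N.contDiffOn_ψ.continuousOn_fderiv_of_isOpen N.isOpen_W (by norm_num)).comp
      continuousOn_fst fun z hz => hz.1
  have h2 : ContinuousOn (fun z : EucSp d × EucSp (D - d) => fderiv ℝ N.ν z.1) (N.W ×ˢ univ) :=
    (N.contDiffOn_ν.continuousOn_fderiv_of_isOpen N.isOpen_W (by norm_num)).comp
      continuousOn_fst fun z hz => hz.1
  have h3 : ContinuousOn (fun z : EucSp d × EucSp (D - d) => N.ν z.1) (N.W ×ˢ univ) :=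
    N.contDiffOn_ν.continuousOn.comp continuousOn_fst fun z hz => hz.1
  have h4 : ContinuousOn (fun z : EucSp d × EucSp (D - d) => (fderiv ℝ N.ν z.1).flip z.2)
      (N.W ×ˢ univ) := by
    have : Continuous fun A : EucSp d →L[ℝ] EucSp (D - d) →L[ℝ] EucSp D => A.flip :=
      (ContinuousLinearMap.flipₗᵢ ℝ _ _ _).continuous
    exact (this.comp_continuousOn h2).clm_apply continuousOn_snd
  exact ((h1.add h4).clm_comp continuousOn_const).add (h3.clm_comp continuousOn_const)

section

variable {τ : ℝ} (hM : IsCompact M) (H : thickening τ M ⊆ uniqueNearestSet M) (hτ : 0 < τ)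

include hM H hτ

/-- In the orthonormal splitting `e` the derivative at `(0, t)` is block triangular, with diagonal
blocks `id + N.shape t` and the identity. The bound on the shape operator controls how the first
block stretches vectors. -/
theorem abs_det_tubeMapDeriv_zero (e : (EucSp d × EucSp (D - d)) ≃L[ℝ] EucSp D)
    (he : ∀ z, e z = N.JT z.1 + N.JN z.2) {t : EucSp (D - d)} (ht : ‖t‖ < τ) :
    (1 - ‖t‖ / τ) ^ d ≤
        |((e.symm : EucSp D →L[ℝ] _).comp (N.tubeMapDeriv (0, t))).det| ∧
      |((e.symm : EucSp D →L[ℝ] _).comp (N.tubeMapDeriv (0, t))).det| ≤ (1 + ‖t‖ / τ) ^ d := by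
  set A : EucSp d →L[ℝ] EucSp d := ContinuousLinearMap.id ℝ _ + N.shape t with hA
  set C : EucSp d →L[ℝ] EucSp (D - d) :=
    (ContinuousLinearMap.adjoint N.JN.toContinuousLinearMap).comp
      ((fderiv ℝ N.ν 0).flip t) with hC
  have hdecomp : ∀ x, N.JT (ContinuousLinearMap.adjoint N.JT.toContinuousLinearMap x) +
      N.JN (ContinuousLinearMap.adjoint N.JN.toContinuousLinearMap x) = x := by
    intro x
    obtain ⟨⟨a, b⟩, rfl⟩ := e.surjective x
    have h1 : ContinuousLinearMap.adjoint N.JT.toContinuousLinearMap (e (a, b)) = a := by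
      refine ext_inner_left ℝ fun v => ?_
      rw [ContinuousLinearMap.adjoint_inner_right, he]
      simp [inner_add_right, N.inner_JT_JN]
    have h2 : ContinuousLinearMap.adjoint N.JN.toContinuousLinearMap (e (a, b)) = b := by
      refine ext_inner_left ℝ fun v => ?_
      rw [ContinuousLinearMap.adjoint_inner_right, he]
      have := N.inner_JT_JN a v
      rw [real_inner_comm] at this
      simp [inner_add_right, this]
    rw [h1, h2, he]
  have hdet : ((e.symm : EucSp D →L[ℝ] _).comp (N.tubeMapDeriv (0, t))).det = A.det := by
    rw [ContinuousLinearMap.det, ContinuousLinearMap.det,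
      ← det_prod_comp_fst_add_snd A.toLinearMap C.toLinearMap]
    congr 1
    refine LinearMap.ext fun z => ?_
    refine e.injective ?_
    change e (e.symm (N.tubeMapDeriv (0, t) z)) = e (A z.1, C z.1 + z.2)
    rw [e.apply_symm_apply, he]
    have h1 := hdecomp (fderiv ℝ N.ν 0 z.1 t)
    simp only [tubeMapDeriv, N.fderiv_ψ_zero, N.ν_zero, hA, hC, shape]
    simp
    nth_rewrite 1 [← h1]
    abel
  rw [hdet]
  have hS := N.norm_shape_apply_le hM H hτ t
  have hc : ‖t‖ / τ < 1 := (div_lt_one hτ).2 ht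
  constructor
  · refine pow_le_abs_det A (by linarith) fun x => ?_
    have h1 : ‖x‖ - ‖N.shape t x‖ ≤ ‖x + N.shape t x‖ := by
      have := norm_sub_le (x + N.shape t x) (N.shape t x)
      rw [add_sub_cancel_right] at this
      linarith
    have : A x = x + N.shape t x := rfl
    rw [this]
    linarith [hS x]
  · refine abs_det_le_pow A (by positivity) fun x => ?_
    have : A x = x + N.shape t x := rfl
    rw [this]
    linarith [hS x, norm_add_le x (N.shape t x)]

/-- The tube lemma: by compactness of the closed `R`-ball, strict bounds over `w = 0` persist for
`w` near `0`, uniformly in `t`. -/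
theorem eventually_abs_det_tubeMapDeriv (e : (EucSp d × EucSp (D - d)) ≃L[ℝ] EucSp D)
    (he : ∀ z, e z = N.JT z.1 + N.JN z.2) {R lo hi : ℝ} (hR : R < τ)
    (hlo : lo < (1 - R / τ) ^ d) (hhi : (1 + R / τ) ^ d < hi) :
    ∀ᶠ w in 𝓝 (0 : EucSp d), ∀ t : EucSp (D - d), ‖t‖ ≤ R →
      lo < |((e.symm : EucSp D →L[ℝ] _).comp (N.tubeMapDeriv (w, t))).det| ∧
      |((e.symm : EucSp D →L[ℝ] _).comp (N.tubeMapDeriv (w, t))).det| < hi := by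
  set f : EucSp d × EucSp (D - d) → ℝ := fun z =>
    |((e.symm : EucSp D →L[ℝ] _).comp (N.tubeMapDeriv z)).det| with hf
  have hcont : ContinuousOn f (N.W ×ˢ univ) :=
    (ContinuousLinearMap.continuous_det.comp_continuousOn
      (continuousOn_const.clm_comp N.continuousOn_tubeMapDeriv)).abs
  have hopen : IsOpen ((N.W ×ˢ univ) ∩ f ⁻¹' Ioo lo hi) :=
    hcont.isOpen_inter_preimage (N.isOpen_W.prod isOpen_univ) isOpen_Ioo
  have hsub : ({0} : Set (EucSp d)) ×ˢ closedBall (0 : EucSp (D - d)) R ⊆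
      (N.W ×ˢ univ) ∩ f ⁻¹' Ioo lo hi := by
    rintro ⟨w, t⟩ ⟨hw, ht⟩
    rw [mem_singleton_iff] at hw
    simp only at hw
    subst hw
    rw [mem_closedBall_zero_iff] at ht
    simp only at ht
    have h := N.abs_det_tubeMapDeriv_zero hM H hτ e he (ht.trans_lt hR)
    have h1 : ‖t‖ / τ ≤ R / τ := by gcongr
    have h2 : R / τ < 1 := (div_lt_one hτ).2 hR
    refine ⟨⟨N.zero_mem, mem_univ _⟩, ?_, ?_⟩
    · refine (hlo.trans_le ?_).trans_le h.1
      exact pow_le_pow_left₀ (by linarith) (by linarith) d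
    · refine (h.2.trans ?_).trans_lt hhi
      gcongr
  obtain ⟨u, v, hu, -, h0u, hv, huv⟩ :=
    generalized_tube_lemma isCompact_singleton (isCompact_closedBall _ _) hopen hsub
  filter_upwards [hu.mem_nhds (h0u rfl)] with w hw t ht
  exact (huv (mk_mem_prod hw (hv (mem_closedBall_zero_iff.2 ht)))).2

end

theorem exists_nhds_dist_le {K : ℝ} (hK : 1 < K) :
    ∃ V ∈ 𝓝 (0 : EucSp d), ∀ w ∈ V, ∀ w' ∈ V,
      dist (N.ψ w) (N.ψ w') ≤ K * dist w w' ∧ dist w w' ≤ K * dist (N.ψ w) (N.ψ w') := by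
  have hs : HasStrictFDerivAt N.ψ N.JT.toContinuousLinearMap 0 :=
    (N.contDiffAt_ψ N.zero_mem).hasStrictFDerivAt' N.hasFDerivAt_ψ_zero (by norm_num)
  have hη : 0 < 1 - 1 / K := by
    rw [sub_pos, div_lt_one (by linarith)]; exact hK
  obtain ⟨V, hV, hA⟩ := hs.approximates_deriv_on_nhds (c := ⟨1 - 1 / K, hη.le⟩) (Or.inr hη)
  refine ⟨V, hV, fun w hw w' hw' => ?_⟩
  rw [dist_eq_norm, dist_eq_norm]
  exact norm_le_mul_of_norm_sub_le hK (N.JT.norm_map _) (hA w hw w' hw')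

theorem eventually_norm_ν_le {K : ℝ} (hK : 1 < K) :
    ∀ᶠ w in 𝓝 (0 : EucSp d), ∀ t, ‖N.ν w t‖ ≤ K * ‖t‖ ∧ ‖t‖ ≤ K * ‖N.ν w t‖ :=
  (N.contDiffAt_ν N.zero_mem).continuousAt.eventually_norm_apply_le N.ν_zero hK

theorem eventually_norm_fderiv_ψ_le {K : ℝ} (hK : 1 < K) :
    ∀ᶠ w in 𝓝 (0 : EucSp d), ∀ u,
      ‖fderiv ℝ N.ψ w u‖ ≤ K * ‖u‖ ∧ ‖u‖ ≤ K * ‖fderiv ℝ N.ψ w u‖ :=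
  N.hasFDerivAt_fderiv_ψ.continuousAt.eventually_norm_apply_le N.fderiv_ψ_zero hK

end NormalParam

/-! ### Local volume estimates for the tube. -/

theorem ContinuousOn.measurableSet_inter_preimage {X Y : Type*} [TopologicalSpace X]
    [MeasurableSpace X] [BorelSpace X] [TopologicalSpace Y] [MeasurableSpace Y] [BorelSpace Y]
    {f : X → Y} {s : Set X} (hf : ContinuousOn f s) (hs : MeasurableSet s) {t : Set Y}
    (ht : MeasurableSet t) : MeasurableSet (s ∩ f ⁻¹' t) := by
  have h1 : MeasurableSet (s.domRestrict f ⁻¹' t) :=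
    (continuousOn_iff_continuous_domRestrict.1 hf).measurable ht
  have h2 := hs.subtype_image h1
  have h3 : Subtype.val '' (s.domRestrict f ⁻¹' t) = s ∩ f ⁻¹' t := by
    ext x; simp [and_comm (a := x ∈ s)]
  rwa [h3] at h2

namespace NormalParam

variable {D d : ℕ} {M : Set (EucSp D)} {p : EucSp D} (N : NormalParam d M p)
variable {τ : ℝ} (hM : IsCompact M) (H : thickening τ M ⊆ uniqueNearestSet M) (hτ : 0 < τ)

include N hM H hτ

theorem exists_isOpen_bounds (e : (EucSp d × EucSp (D - d)) ≃L[ℝ] EucSp D)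
    (he : ∀ z, e z = N.JT z.1 + N.JN z.2) {K R lo hi : ℝ} (hK : 1 < K) (hR : R < τ)
    (hlo : lo < (1 - R / τ) ^ d) (hhi : (1 + R / τ) ^ d < hi) :
    ∃ V ⊆ N.W, IsOpen V ∧ 0 ∈ V ∧
      (∀ w ∈ V, ∀ t : EucSp (D - d), ‖t‖ ≤ R →
        lo < |((e.symm : EucSp D →L[ℝ] _).comp (N.tubeMapDeriv (w, t))).det| ∧
        |((e.symm : EucSp D →L[ℝ] _).comp (N.tubeMapDeriv (w, t))).det| < hi) ∧
      (∀ w ∈ V, ∀ w' ∈ V,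
        dist (N.ψ w) (N.ψ w') ≤ K * dist w w' ∧ dist w w' ≤ K * dist (N.ψ w) (N.ψ w')) ∧
      ∀ w ∈ V, ∀ t, ‖N.ν w t‖ ≤ K * ‖t‖ ∧ ‖t‖ ≤ K * ‖N.ν w t‖ := by
  obtain ⟨V₁, hV₁, h₁⟩ := N.exists_nhds_dist_le hK
  obtain ⟨V, hV, hVo, h0⟩ := _root_.mem_nhds_iff.1 (inter_mem (inter_mem hV₁ (N.mem_nhds N.zero_mem))
    ((N.eventually_abs_det_tubeMapDeriv hM H hτ e he hR hlo hhi).and (N.eventually_norm_ν_le hK)))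
  exact ⟨V, fun w hw => (hV hw).1.2, hVo, h0, fun w hw => (hV hw).2.1,
    fun w hw w' hw' => h₁ w (hV hw).1.1 w' (hV hw').1.1, fun w hw => (hV hw).2.2⟩

theorem exists_isOpen_volume_tubePreimage_le (hdD : d ≤ D) {σ : ℝ} (hστ : σ < τ)
    {C : ℝ} (hC : (1 + σ / τ) ^ d < C) :
    ∃ O, IsOpen O ∧ p ∈ O ∧ ∀ U ⊆ M ∩ O, MeasurableSet U →
      volume (tubePreimage M σ U) ≤
        ENNReal.ofReal C * ((μHE[d] : Measure (EucSp D)) U * volume (ball (0 : EucSp (D - d)) σ)) := by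
  obtain ⟨e, he, hev⟩ := N.exists_prod_equiv hdD
  -- The slack in `C` pays for `K ^ D`: a factor `K ^ d` from the distortion of `ψ`, and `K ^ (D -
  -- d)` from enlarging the normal ball to radius `K * σ`, which is needed as `‖t‖ ≤ K * ‖N.ν w t‖`.
  have hlim : ∀ᶠ K : ℝ in 𝓝[>] 1, (1 + K * σ / τ) ^ d * K ^ D < C ∧ K * σ < τ := by
    refine nhdsWithin_le_nhds (Filter.Eventually.and ?_ ?_)
    · have : ContinuousAt (fun K : ℝ => (1 + K * σ / τ) ^ d * K ^ D) 1 := by fun_prop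
      exact this.eventually (gt_mem_nhds (by simpa using hC))
    · have : ContinuousAt (fun K : ℝ => K * σ) 1 := by fun_prop
      exact this.eventually (gt_mem_nhds (by simpa using hστ))
  obtain ⟨K, ⟨hK1, hK2⟩, hK : 1 < K⟩ := (hlim.and self_mem_nhdsWithin).exists
  have hK0 : 0 < K := by linarith
  have hhi : (1 + K * σ / τ) ^ d < C / K ^ D := by rwa [lt_div_iff₀ (by positivity)]
  obtain ⟨V, hVW, hVo, h0V, hdet, hdist, hν⟩ := N.exists_isOpen_bounds hM H hτ e he hK hK2
    (sub_one_lt _) hhi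
  obtain ⟨O, hO, hVO⟩ := N.exists_image_eq V hVW hVo
  refine ⟨O, hO, ?_, fun U hU hUm => ?_⟩
  · have : N.ψ 0 ∈ M ∩ O := hVO ▸ mem_image_of_mem _ h0V
    rw [N.ψ_zero] at this
    exact this.2
  rw [← hVO] at hU
  set W' := V ∩ N.ψ ⁻¹' U with hW'
  have hW'm : MeasurableSet W' :=
    (N.contDiffOn_ψ.continuousOn.mono hVW).measurableSet_inter_preimage hVo.measurableSet hUm
  have hψW' : N.ψ '' W' = U := by
    rw [hW', image_inter_preimage, inter_eq_right.2 hU]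
  set S := W' ×ˢ ball (0 : EucSp (D - d)) (K * σ) with hS
  have hSm : MeasurableSet S := hW'm.prod measurableSet_ball
  have hsub : tubePreimage M σ U ⊆ N.tubeMap '' S := by
    rintro z ⟨hz, hzU⟩
    have hzn := isNearestPoint_nearestPointProj H (thickening_mono hστ.le M hz)
    rw [← hψW'] at hzU
    obtain ⟨w, hw, hwz⟩ := hzU
    rw [← hwz] at hzn
    obtain ⟨t, ht⟩ := N.exists_eq_add_ν hdD (hVW hw.1) hzn
    refine ⟨(w, t), ⟨hw, ?_⟩, ht.symm⟩
    have h1 : ‖N.ν w t‖ < σ := by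
      have h2 := infDist_lt_of_mem_thickening hz
      rw [← hzn.2, dist_comm, dist_eq_norm, ht, add_sub_cancel_left] at h2
      exact h2
    rw [mem_ball_zero_iff]
    exact ((hν w hw.1 t).2).trans_lt (by gcongr)
  have hvolS : volume (N.tubeMap '' S) ≤ ENNReal.ofReal (C / K ^ D) * volume S := by
    have h1 : N.tubeMap '' S = e '' ((e.symm ∘ N.tubeMap) '' S) := by
      rw [image_comp, ← image_comp e, e.self_comp_symm, image_id]
    have : (volume : Measure (EucSp d × EucSp (D - d))).IsAddHaarMeasure :=
      Measure.prod.instIsAddHaarMeasure _ _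
    rw [h1, hev]
    refine (addHaar_image_le_lintegral_abs_det_fderiv volume hSm
      (f' := fun z => (e.symm : EucSp D →L[ℝ] _).comp (N.tubeMapDeriv z)) fun z hz =>
      ((e.symm.hasFDerivAt).comp z (N.hasFDerivAt_tubeMap (hVW hz.1.1))).hasFDerivWithinAt).trans ?_
    rw [← setLIntegral_const]
    refine setLIntegral_mono' hSm fun z hz => ENNReal.ofReal_le_ofReal ?_
    exact (hdet z.1 hz.1.1 z.2 (mem_ball_zero_iff.1 hz.2).le).2.le
  have hvolW : volume W' ≤ ENNReal.ofReal (K ^ d) * (μHE[d] : Measure (EucSp D)) U := by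
    rw [← EuclideanSpace.euclideanHausdorffMeasure_eq_volume d, ← hψW', ENNReal.ofReal_pow hK0.le]
    refine euclideanHausdorffMeasure_le_of_edist_le (K := K.toNNReal) (fun w hw w' hw' => ?_) d
    rw [edist_dist, edist_dist]
    change _ ≤ ENNReal.ofReal K * _
    rw [← ENNReal.ofReal_mul hK0.le]
    exact ENNReal.ofReal_le_ofReal (hdist w hw.1 w' hw'.1).2
  calc volume (tubePreimage M σ U) ≤ _ := measure_mono hsub
    _ ≤ _ := hvolS
    _ = ENNReal.ofReal (C / K ^ D) *
        (volume W' * (ENNReal.ofReal (K ^ (D - d)) * volume (ball (0 : EucSp (D - d)) σ))) := by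
      rw [hS, Measure.volume_eq_prod, Measure.prod_prod, Measure.addHaar_ball_mul_of_pos _ _ hK0,
        finrank_euclideanSpace_fin]
    _ ≤ ENNReal.ofReal (C / K ^ D) * ((ENNReal.ofReal (K ^ d) * (μHE[d] : Measure (EucSp D)) U) *
        (ENNReal.ofReal (K ^ (D - d)) * volume (ball (0 : EucSp (D - d)) σ))) := by gcongr
    _ = ENNReal.ofReal (C / K ^ D) * ENNReal.ofReal (K ^ d) * ENNReal.ofReal (K ^ (D - d)) *
        ((μHE[d] : Measure (EucSp D)) U * volume (ball (0 : EucSp (D - d)) σ)) := by ring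
    _ = _ := by
      rw [mul_assoc (ENNReal.ofReal _) (ENNReal.ofReal _), ← ENNReal.ofReal_mul (by positivity),
        ← pow_add, Nat.add_sub_of_le hdD, ← ENNReal.ofReal_mul' (by positivity),
        div_mul_cancel₀ _ (by positivity)]

theorem exists_isOpen_le_volume_tubePreimage (hdD : d ≤ D) {σ : ℝ} (hσ : 0 < σ) (hστ : σ < τ)
    {c : ℝ} (hc : c < (1 - σ / τ) ^ d) :
    ∃ O, IsOpen O ∧ p ∈ O ∧ ∀ U ⊆ M ∩ O, MeasurableSet U →
      ENNReal.ofReal c * ((μHE[d] : Measure (EucSp D)) U * volume (ball (0 : EucSp (D - d)) σ)) ≤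
      volume (tubePreimage M σ U) := by
  obtain ⟨e, he, hev⟩ := N.exists_prod_equiv hdD
  have hlim : ∀ᶠ K : ℝ in 𝓝[>] 1, c * K ^ D < (1 - σ / τ) ^ d := by
    refine nhdsWithin_le_nhds ?_
    have : ContinuousAt (fun K : ℝ => c * K ^ D) 1 := by fun_prop
    exact this.eventually (gt_mem_nhds (by simpa using hc))
  obtain ⟨K, hlo, hK : 1 < K⟩ := (hlim.and self_mem_nhdsWithin).exists
  have hK0 : 0 < K := by linarith
  obtain ⟨V, hVW, hVo, h0V, hdet, hdist, hν⟩ := N.exists_isOpen_bounds hM H hτ e he hK hστ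
    hlo (lt_add_one _)
  obtain ⟨O, hO, hVO⟩ := N.exists_image_eq V hVW hVo
  refine ⟨O, hO, ?_, fun U hU hUm => ?_⟩
  · have : N.ψ 0 ∈ M ∩ O := hVO ▸ mem_image_of_mem _ h0V
    rw [N.ψ_zero] at this
    exact this.2
  rw [← hVO] at hU
  set W' := V ∩ N.ψ ⁻¹' U with hW'
  have hW'm : MeasurableSet W' :=
    (N.contDiffOn_ψ.continuousOn.mono hVW).measurableSet_inter_preimage hVo.measurableSet hUm
  have hψW' : N.ψ '' W' = U := by
    rw [hW', image_inter_preimage, inter_eq_right.2 hU]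
  -- The radius `K⁻¹ * σ` guarantees `‖N.ν w t‖ < σ`, so the tube map sends `S` into the tube, and
  -- the foot point of the image is `N.ψ w`. This also makes the tube map injective on `S`.
  set S := W' ×ˢ ball (0 : EucSp (D - d)) (K⁻¹ * σ) with hS
  have hSm : MeasurableSet S := hW'm.prod measurableSet_ball
  have hνσ : ∀ z ∈ S, ‖N.ν z.1 z.2‖ < σ := fun z hz => by
    have h1 := mem_ball_zero_iff.1 hz.2
    have h2 : K * ‖z.2‖ < K * (K⁻¹ * σ) := by gcongr
    rw [mul_inv_cancel_left₀ hK0.ne'] at h2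
    exact ((hν z.1 hz.1.1 z.2).1).trans_lt h2
  have hproj : ∀ z ∈ S, nearestPointProj M (N.tubeMap z) = N.ψ z.1 := fun z hz =>
    (N.isProximalNormal z.1 (hVW hz.1.1) z.2).nearestPointProj_add hM H ((hνσ z hz).trans hστ)
  have hsub : N.tubeMap '' S ⊆ tubePreimage M σ U := by
    rintro _ ⟨z, hz, rfl⟩
    refine ⟨mem_thickening_of_infDist_lt ⟨_, N.ψ_mem (hVW hz.1.1)⟩ ?_, ?_⟩
    · have := (N.isProximalNormal z.1 (hVW hz.1.1) z.2).infDist_add hM H ((hνσ z hz).trans hστ)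
      exact this.trans_lt (hνσ z hz)
    · rw [hproj z hz]; exact hz.1.2
  have hinj : InjOn N.tubeMap S := fun z hz z' hz' h => by
    have h1 : N.ψ z.1 = N.ψ z'.1 := by rw [← hproj z hz, ← hproj z' hz', h]
    have h2 : z.1 = z'.1 := N.injOn (hVW hz.1.1) (hVW hz'.1.1) h1
    refine Prod.ext h2 (N.injective_ν z.1 (hVW hz.1.1) ?_)
    simp only [tubeMap, ← h2] at h
    exact add_left_cancel h
  have hvolS : ENNReal.ofReal (c * K ^ D) * volume S ≤ volume (N.tubeMap '' S) := by
    have h1 : N.tubeMap '' S = e '' ((e.symm ∘ N.tubeMap) '' S) := by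
      rw [image_comp, ← image_comp e, e.self_comp_symm, image_id]
    have : (volume : Measure (EucSp d × EucSp (D - d))).IsAddHaarMeasure :=
      Measure.prod.instIsAddHaarMeasure _ _
    rw [h1, hev]
    refine le_of_le_of_eq ?_ (lintegral_abs_det_fderiv_eq_addHaar_image volume hSm
      (f' := fun z => (e.symm : EucSp D →L[ℝ] _).comp (N.tubeMapDeriv z)) (fun z hz =>
      ((e.symm.hasFDerivAt).comp z (N.hasFDerivAt_tubeMap (hVW hz.1.1))).hasFDerivWithinAt)
      (e.symm.injective.comp_injOn hinj))
    rw [← setLIntegral_const]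
    refine setLIntegral_mono' hSm fun z hz => ENNReal.ofReal_le_ofReal ?_
    refine (hdet z.1 hz.1.1 z.2 ((mem_ball_zero_iff.1 hz.2).le.trans ?_)).1.le
    rw [inv_mul_le_iff₀ hK0]
    nlinarith
  have hvolW : (μHE[d] : Measure (EucSp D)) U ≤ ENNReal.ofReal (K ^ d) * volume W' := by
    rw [← EuclideanSpace.euclideanHausdorffMeasure_eq_volume d, ← hψW', ENNReal.ofReal_pow hK0.le]
    have hLip : LipschitzOnWith K.toNNReal N.ψ W' := fun w hw w' hw' => by
      rw [edist_dist, edist_dist]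
      change _ ≤ ENNReal.ofReal K * _
      rw [← ENNReal.ofReal_mul hK0.le]
      exact ENNReal.ofReal_le_ofReal (hdist w hw.1 w' hw'.1).1
    exact hLip.euclideanHausdorffMeasure_image_le d
  have hball : volume (ball (0 : EucSp (D - d)) σ) =
      ENNReal.ofReal (K ^ (D - d)) * volume (ball (0 : EucSp (D - d)) (K⁻¹ * σ)) := by
    have := Measure.addHaar_ball_mul_of_pos volume (0 : EucSp (D - d)) hK0 (K⁻¹ * σ)
    rwa [mul_inv_cancel_left₀ hK0.ne', finrank_euclideanSpace_fin] at this
  calc _ ≤ ENNReal.ofReal c * ((ENNReal.ofReal (K ^ d) * volume W') *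
        (ENNReal.ofReal (K ^ (D - d)) * volume (ball (0 : EucSp (D - d)) (K⁻¹ * σ)))) := by
        rw [hball]; gcongr
    _ = ENNReal.ofReal c * ENNReal.ofReal (K ^ d) * ENNReal.ofReal (K ^ (D - d)) * volume S := by
      rw [hS, Measure.volume_eq_prod, Measure.prod_prod]; ring
    _ = ENNReal.ofReal (c * K ^ D) * volume S := by
      rw [mul_assoc (ENNReal.ofReal _) (ENNReal.ofReal _), ← ENNReal.ofReal_mul (by positivity),
        ← pow_add, Nat.add_sub_of_le hdD, ← ENNReal.ofReal_mul' (by positivity)]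
    _ ≤ _ := hvolS
    _ ≤ _ := measure_mono hsub

end NormalParam

/-! ### From local to global volume estimates. -/

section Global

variable {D d : ℕ} {M : Set (EucSp D)}
variable {τ : ℝ} (hM : IsCompact M) (hMd : IsC2Submanifold d M)
  (H : thickening τ M ⊆ uniqueNearestSet M) (hτ : 0 < τ)

theorem tubePreimage_inter (σ : ℝ) (U O : Set (EucSp D)) :
    tubePreimage M σ (U ∩ O) = tubePreimage M σ U ∩ tubePreimage M σ O := by
  ext z
  exact ⟨fun h => ⟨⟨h.1, h.2.1⟩, h.1, h.2.2⟩, fun h => ⟨h.1.1, h.1.2, h.2.2⟩⟩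

theorem tubePreimage_diff (σ : ℝ) (U O : Set (EucSp D)) :
    tubePreimage M σ (U \ O) = tubePreimage M σ U \ tubePreimage M σ O := by
  ext z
  exact ⟨fun h => ⟨⟨h.1, h.2.1⟩, fun h' => h.2.2 h'.2⟩, fun h => ⟨h.1.1, h.1.2, fun h' =>
    h.2 ⟨h.1.1, h'⟩⟩⟩

theorem tubePreimage_mono (σ : ℝ) {U U' : Set (EucSp D)} (h : U ⊆ U') :
    tubePreimage M σ U ⊆ tubePreimage M σ U' := fun _ hz => ⟨hz.1, h hz.2⟩

include hM H in
theorem isOpen_tubePreimage {σ : ℝ} (hστ : σ < τ) {O : Set (EucSp D)} (hO : IsOpen O) :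
    IsOpen (tubePreimage M σ O) :=
  ((continuousOn_nearestPointProj hM H).mono (thickening_mono hστ.le M)).isOpen_inter_preimage
    isOpen_thickening hO

include hM hMd H hτ

/-- Compact induction: both sides are additive when `U` is cut by an open set `O`, the preimage of
`O` being open by continuity of the projection. -/
theorem volume_tubePreimage_le_of_lt (hdD : d ≤ D) {σ : ℝ} (hστ : σ < τ)
    {C : ℝ} (hC : (1 + σ / τ) ^ d < C) {U : Set (EucSp D)} (hUM : U ⊆ M) (hU : MeasurableSet U) :
    volume (tubePreimage M σ U) ≤
      ENNReal.ofReal C * ((μHE[d] : Measure (EucSp D)) U * volume (ball (0 : EucSp (D - d)) σ)) := by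
  obtain ⟨O, hO, hMO, h⟩ := hM.induction_on (p := fun S => ∃ O, IsOpen O ∧ S ⊆ O ∧
      ∀ U ⊆ M ∩ O, MeasurableSet U → volume (tubePreimage M σ U) ≤ ENNReal.ofReal C *
        ((μHE[d] : Measure (EucSp D)) U * volume (ball (0 : EucSp (D - d)) σ)))
    ⟨∅, isOpen_empty, subset_rfl, fun U hU _ => by
      rw [inter_empty, subset_empty_iff] at hU
      simp [hU, tubePreimage]⟩
    (fun S T hST ⟨O, hO, hTO, h⟩ => ⟨O, hO, hST.trans hTO, h⟩)
    (fun S T ⟨O, hO, hSO, h⟩ ⟨O', hO', hTO', h'⟩ => by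
      refine ⟨O ∪ O', hO.union hO', union_subset_union hSO hTO', fun U hU hUm => ?_⟩
      have h1 := h (U ∩ O) (fun x hx => ⟨(hU hx.1).1, hx.2⟩) (hUm.inter hO.measurableSet)
      have h2 := h' (U \ O) (fun x hx => ⟨(hU hx.1).1, (hU hx.1).2.resolve_left hx.2⟩)
        (hUm.diff hO.measurableSet)
      rw [tubePreimage_inter] at h1
      rw [tubePreimage_diff] at h2
      rw [← measure_inter_add_sdiff (tubePreimage M σ U)
        (isOpen_tubePreimage hM H hστ hO).measurableSet,
        ← measure_inter_add_sdiff U hO.measurableSet, add_mul, mul_add]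
      exact add_le_add h1 h2)
    (fun p hp => by
      obtain ⟨N⟩ := nonempty_normalParam hMd hp
      obtain ⟨O, hO, hpO, h⟩ := N.exists_isOpen_volume_tubePreimage_le hM H hτ hdD hστ hC
      exact ⟨O, mem_nhdsWithin_of_mem_nhds (hO.mem_nhds hpO), O, hO, subset_rfl, h⟩)
  exact h U (subset_inter hUM (hUM.trans hMO)) hU

theorem le_volume_tubePreimage_of_lt (hdD : d ≤ D) {σ : ℝ} (hσ : 0 < σ) (hστ : σ < τ)
    {c : ℝ} (hc : c < (1 - σ / τ) ^ d) {U : Set (EucSp D)} (hUM : U ⊆ M) (hU : MeasurableSet U) :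
    ENNReal.ofReal c * ((μHE[d] : Measure (EucSp D)) U * volume (ball (0 : EucSp (D - d)) σ)) ≤
      volume (tubePreimage M σ U) := by
  obtain ⟨O, hO, hMO, h⟩ := hM.induction_on (p := fun S => ∃ O, IsOpen O ∧ S ⊆ O ∧
      ∀ U ⊆ M ∩ O, MeasurableSet U → ENNReal.ofReal c *
        ((μHE[d] : Measure (EucSp D)) U * volume (ball (0 : EucSp (D - d)) σ)) ≤
        volume (tubePreimage M σ U))
    ⟨∅, isOpen_empty, subset_rfl, fun U hU _ => by
      rw [inter_empty, subset_empty_iff] at hU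
      simp [hU]⟩
    (fun S T hST ⟨O, hO, hTO, h⟩ => ⟨O, hO, hST.trans hTO, h⟩)
    (fun S T ⟨O, hO, hSO, h⟩ ⟨O', hO', hTO', h'⟩ => by
      refine ⟨O ∪ O', hO.union hO', union_subset_union hSO hTO', fun U hU hUm => ?_⟩
      have h1 := h (U ∩ O) (fun x hx => ⟨(hU hx.1).1, hx.2⟩) (hUm.inter hO.measurableSet)
      have h2 := h' (U \ O) (fun x hx => ⟨(hU hx.1).1, (hU hx.1).2.resolve_left hx.2⟩)
        (hUm.diff hO.measurableSet)
      rw [tubePreimage_inter] at h1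
      rw [tubePreimage_diff] at h2
      rw [← measure_inter_add_sdiff (tubePreimage M σ U)
        (isOpen_tubePreimage hM H hστ hO).measurableSet,
        ← measure_inter_add_sdiff U hO.measurableSet, add_mul, mul_add]
      exact add_le_add h1 h2)
    (fun p hp => by
      obtain ⟨N⟩ := nonempty_normalParam hMd hp
      obtain ⟨O, hO, hpO, h⟩ := N.exists_isOpen_le_volume_tubePreimage hM H hτ hdD hσ hστ hc
      exact ⟨O, mem_nhdsWithin_of_mem_nhds (hO.mem_nhds hpO), O, hO, subset_rfl, h⟩)
  exact h U (subset_inter hUM (hUM.trans hMO)) hU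

theorem volume_tubePreimage_le (hdD : d ≤ D) {σ : ℝ} (hσ : 0 ≤ σ) (hστ : σ < τ)
    {U : Set (EucSp D)} (hUM : U ⊆ M) :
    volume (tubePreimage M σ U) ≤
      ENNReal.ofReal ((1 + σ / τ) ^ d) * volM d M U * volume (ball (0 : EucSp (D - d)) σ) := by
  rcases hσ.eq_or_lt with rfl | hσ
  · simp [tubePreimage, thickening_of_nonpos le_rfl]
  -- The upper bound is monotone in the right direction, so an arbitrary `U` may be replaced by a
  -- measurable hull inside `M`.
  set U' := toMeasurable (volM d M) U ∩ M with hU'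
  have hU'm : MeasurableSet U' := (measurableSet_toMeasurable _ _).inter hM.measurableSet
  have hvol : volM d M U = (μHE[d] : Measure (EucSp D)) U' := by
    rw [← measure_toMeasurable, volM, Measure.restrict_apply' hM.measurableSet]; rfl
  rw [hvol, mul_assoc]
  refine (measure_mono (tubePreimage_mono σ
    (subset_inter (subset_toMeasurable (volM d M) U) hUM))).trans ?_
  have hpos : 0 < (1 + σ / τ) ^ d := by positivity
  have hlim : Tendsto (fun C : ℝ => ENNReal.ofReal C *
      ((μHE[d] : Measure (EucSp D)) U' * volume (ball (0 : EucSp (D - d)) σ)))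
      (𝓝[>] ((1 + σ / τ) ^ d)) (𝓝 (ENNReal.ofReal ((1 + σ / τ) ^ d) *
      ((μHE[d] : Measure (EucSp D)) U' * volume (ball (0 : EucSp (D - d)) σ)))) :=
    ENNReal.Tendsto.mul_const
      ((ENNReal.continuous_ofReal.tendsto _).mono_left nhdsWithin_le_nhds)
      -- The limit of the constants is nonzero, so finiteness of the area is not needed.
      (Or.inl (ENNReal.ofReal_pos.2 hpos).ne')
  exact ge_of_tendsto hlim (eventually_mem_nhdsWithin.mono fun C hC =>
    volume_tubePreimage_le_of_lt hM hMd H hτ hdD hστ hC inter_subset_right hU'm)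

theorem le_volume_tubePreimage (hdD : d ≤ D) {σ : ℝ} (hσ : 0 ≤ σ) (hστ : σ < τ)
    {U : Set (EucSp D)} (hUM : U ⊆ M) (hU : NullMeasurableSet U (volM d M)) :
    ENNReal.ofReal ((1 - σ / τ) ^ d) * volM d M U * volume (ball (0 : EucSp (D - d)) σ) ≤
      volume (tubePreimage M σ U) := by
  rcases hσ.eq_or_lt with rfl | hσ
  · simp
  obtain ⟨U', hU'U, hU'm, hU'e⟩ := hU.exists_measurable_subset_ae_eq
  have hvol : volM d M U = (μHE[d] : Measure (EucSp D)) U' := by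
    rw [← measure_congr hU'e, volM, Measure.restrict_eq_self _ (hU'U.trans hUM)]
  rw [hvol, mul_assoc]
  refine le_trans ?_ (measure_mono (tubePreimage_mono σ hU'U))
  have h1 : σ / τ < 1 := (div_lt_one hτ).2 hστ
  have hpos : 0 < (1 - σ / τ) ^ d := pow_pos (by linarith) d
  have hlim : Tendsto (fun C : ℝ => ENNReal.ofReal C *
      ((μHE[d] : Measure (EucSp D)) U' * volume (ball (0 : EucSp (D - d)) σ)))
      (𝓝[<] ((1 - σ / τ) ^ d)) (𝓝 (ENNReal.ofReal ((1 - σ / τ) ^ d) *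
      ((μHE[d] : Measure (EucSp D)) U' * volume (ball (0 : EucSp (D - d)) σ)))) :=
    ENNReal.Tendsto.mul_const
      ((ENNReal.continuous_ofReal.tendsto _).mono_left nhdsWithin_le_nhds)
      (Or.inl (ENNReal.ofReal_pos.2 hpos).ne')
  exact le_of_tendsto hlim (eventually_mem_nhdsWithin.mono fun C hC =>
    le_volume_tubePreimage_of_lt hM hMd H hτ hdD hσ hστ hC (hU'U.trans hUM) hU'm)

end Global

/-! ### Turning of the normal spaces and the area of `M` in a small ball. -/

theorem norm_starProjection_sub_le {E : Type*} [NormedAddCommGroup E] [InnerProductSpace ℝ E]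
    (K L : Submodule ℝ E) [K.HasOrthogonalProjection] [L.HasOrthogonalProjection] {s : ℝ}
    (hs : 0 ≤ s) (h₁ : ∀ k ∈ K, ∀ l ∈ Lᗮ, |⟪k, l⟫| ≤ s * ‖k‖ * ‖l‖)
    (h₂ : ∀ k ∈ Kᗮ, ∀ l ∈ L, |⟪k, l⟫| ≤ s * ‖k‖ * ‖l‖) :
    ‖K.starProjection - L.starProjection‖ ≤ s := by
  refine ContinuousLinearMap.opNorm_le_bound _ hs fun x => ?_
  set l := L.starProjection x with hl
  set m := x - l with hm
  have hlL : l ∈ L := L.starProjection_apply_mem x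
  have hmL : m ∈ Lᗮ := L.sub_starProjection_mem_orthogonal x
  set a := K.starProjection m with ha
  set b := l - K.starProjection l with hb
  have haK : a ∈ K := K.starProjection_apply_mem m
  have hbK : b ∈ Kᗮ := K.sub_starProjection_mem_orthogonal l
  -- The difference splits into orthogonal pieces `a` in `K` and `b` in `Kᗮ`, controlled by the
  -- orthogonal parts `m` and `l` of `x`. By Pythagoras no factor is lost.
  have hdec : (K.starProjection - L.starProjection) x = a - b := by
    rw [sub_apply, ha, hb, hm, map_sub, ← hl]; abel
  have hab : ⟪a, b⟫ = 0 := hbK a haK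
  have hlm : ⟪l, m⟫ = 0 := hmL l hlL
  have h1 : ‖a‖ ≤ s * ‖m‖ := by
    have h3 := (le_abs_self _).trans (h₁ a haK m hmL)
    have h4 : ⟪a, m⟫ = ‖a‖ ^ 2 := by
      have h5 : ⟪a, m - a⟫ = 0 := K.sub_starProjection_mem_orthogonal m a haK
      rw [inner_sub_right, real_inner_self_eq_norm_sq] at h5
      linarith
    rcases (norm_nonneg a).eq_or_lt with h0 | h0
    · rw [← h0]; positivity
    · exact le_of_mul_le_mul_left (by nlinarith) h0
  have h2 : ‖b‖ ≤ s * ‖l‖ := by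
    have h3 := (le_abs_self _).trans (h₂ b hbK l hlL)
    have h4 : ⟪b, l⟫ = ‖b‖ ^ 2 := by
      have h5 : ⟪K.starProjection l, b⟫ = 0 := hbK _ (K.starProjection_apply_mem l)
      rw [real_inner_comm] at h5
      have h6 : l = b + K.starProjection l := by rw [hb]; abel
      nth_rewrite 1 [h6]
      rw [inner_add_right, h5, real_inner_self_eq_norm_sq, add_zero]
    rcases (norm_nonneg b).eq_or_lt with h0 | h0
    · rw [← h0]; positivity
    · exact le_of_mul_le_mul_left (by nlinarith) h0
  have hx : ‖x‖ ^ 2 = ‖l‖ ^ 2 + ‖m‖ ^ 2 := by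
    rw [show x = l + m by rw [hm]; abel, norm_add_sq_real, hlm]; ring
  refine le_of_sq_le_sq ?_ (by positivity)
  rw [hdec, norm_sub_sq_real, hab, mul_pow, hx]
  have h5 := pow_le_pow_left₀ (norm_nonneg a) h1 2
  have h6 := pow_le_pow_left₀ (norm_nonneg b) h2 2
  nlinarith

theorem one_le_one_sub_sq_mul_one_add_sq {x : ℝ} (hx0 : 0 < x) (hx8 : x ≤ 1 / 8) :
    1 ≤ (1 - (x + x / (1 - x / 2)) ^ 2) * (1 + (2 * x / (1 - 2 * x)) ^ 2) := by
  have h2 : 0 < 2 - x := by linarith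
  have h3 : 0 < 1 - 2 * x := by linarith
  have h1 : x + x / (1 - x / 2) = x * (4 - x) / (2 - x) := by
    rw [show 1 - x / 2 = (2 - x) / 2 by ring]
    field_simp; ring
  have h4 : (1 - (x * (4 - x) / (2 - x)) ^ 2) * (1 + (2 * x / (1 - 2 * x)) ^ 2) - 1 =
      x ^ 2 * (4 * (2 - x) ^ 2 - (4 - x) ^ 2 * ((1 - 2 * x) ^ 2 + 4 * x ^ 2)) /
        ((2 - x) ^ 2 * (1 - 2 * x) ^ 2) := by
    have key : ∀ A B b c : ℝ, b ≠ 0 → c ≠ 0 → (1 - (A / b) ^ 2) * (1 + (B / c) ^ 2) - 1 =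
        (b ^ 2 * B ^ 2 - A ^ 2 * (c ^ 2 + B ^ 2)) / (b ^ 2 * c ^ 2) := by
      intro A B b c hb hc
      field_simp
      ring
    rw [key _ _ _ _ h2.ne' h3.ne']
    ring
  have h5 : (4 - x) ^ 2 * ((1 - 2 * x) ^ 2 + 4 * x ^ 2) ≤ 4 * (2 - x) ^ 2 := by
    have h6 : (4 - x) ^ 2 ≤ 16 := by nlinarith
    -- This is equivalent to `8 * x ^ 2 ≤ x`; here the bound `1 / 8` enters.
    have h7 : (1 - 2 * x) ^ 2 + 4 * x ^ 2 ≤ 1 - 3 * x := by nlinarith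
    have h8 : 0 ≤ (1 - 2 * x) ^ 2 + 4 * x ^ 2 := by positivity
    nlinarith
  have h9 : 0 ≤ (1 - (x * (4 - x) / (2 - x)) ^ 2) * (1 + (2 * x / (1 - 2 * x)) ^ 2) - 1 := by
    rw [h4]
    exact div_nonneg (mul_nonneg (sq_nonneg x) (by linarith)) (by positivity)
  rw [h1]
  linarith

section Normal

variable {D d : ℕ}

/-- The normal space of `M` at `x`. -/
def normalSub (M : Set (EucSp D)) (x : EucSp D) : Submodule ℝ (EucSp D) :=
  Submodule.span ℝ {v | IsProximalNormal M x v}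

variable {M : Set (EucSp D)} {p : EucSp D}

namespace NormalParam

variable (N : NormalParam d M p)

theorem isProximalNormal_iff (hdD : d ≤ D) {w : EucSp d} (hw : w ∈ N.W) {v : EucSp D} :
    IsProximalNormal M (N.ψ w) v ↔ ∃ t, N.ν w t = v := by
  constructor
  · rintro ⟨s, hs, h⟩
    obtain ⟨t, ht⟩ := N.exists_eq_add_ν hdD hw h
    refine ⟨s⁻¹ • t, ?_⟩
    rw [map_smul, ← add_left_cancel ht, inv_smul_smul₀ hs.ne']
  · rintro ⟨t, rfl⟩
    exact N.isProximalNormal w hw t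

theorem normalSub_eq (hdD : d ≤ D) {w : EucSp d} (hw : w ∈ N.W) :
    normalSub M (N.ψ w) = LinearMap.range (N.ν w).toLinearMap := by
  have : {v | IsProximalNormal M (N.ψ w) v} = (LinearMap.range (N.ν w).toLinearMap : Set _) := by
    ext v
    exact N.isProximalNormal_iff hdD hw
  rw [normalSub, this, Submodule.span_eq]

theorem exists_fderiv_eq (hdD : d ≤ D) {w : EucSp d} (hw : w ∈ N.W) {v : EucSp D}
    (hv : v ∈ (normalSub M (N.ψ w))ᗮ) : ∃ u, fderiv ℝ N.ψ w u = v := by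
  set K := LinearMap.range (fderiv ℝ N.ψ w).toLinearMap with hK
  have h1 : Kᗮ ≤ normalSub M (N.ψ w) := by
    intro x hx
    rw [N.normalSub_eq hdD hw]
    exact N.exists_ν_eq hdD hw fun u => hx _ ⟨u, rfl⟩
  have h2 := Submodule.orthogonal_le h1 hv
  rw [Submodule.orthogonal_orthogonal] at h2
  exact h2

include N in
theorem isProximalNormal_of_mem_normalSub (hdD : d ≤ D) {v : EucSp D} (hv : v ∈ normalSub M p) :
    IsProximalNormal M p v := by
  rw [← N.ψ_zero, N.normalSub_eq hdD N.zero_mem] at hv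
  have := (N.isProximalNormal_iff hdD N.zero_mem).2 hv
  rwa [N.ψ_zero] at this

theorem norm_adjoint_JT_le (u : EucSp D) :
    ‖ContinuousLinearMap.adjoint N.JT.toContinuousLinearMap u‖ ≤ ‖u‖ := by
  refine (ContinuousLinearMap.le_opNorm _ _).trans ?_
  rw [LinearIsometryEquiv.norm_map]
  exact mul_le_of_le_one_left (norm_nonneg u) N.JT.norm_toContinuousLinearMap_le

theorem norm_sq_le_add (hdD : d ≤ D) (u : EucSp D) :
    ‖u‖ ^ 2 ≤ ‖ContinuousLinearMap.adjoint N.JT.toContinuousLinearMap u‖ ^ 2 +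
      ‖(normalSub M p).starProjection u‖ ^ 2 := by
  obtain ⟨e, he, -⟩ := N.exists_prod_equiv hdD
  obtain ⟨⟨α, β⟩, hαβ⟩ := e.surjective u
  rw [he] at hαβ
  have hα : ContinuousLinearMap.adjoint N.JT.toContinuousLinearMap u = α := by
    refine ext_inner_left ℝ fun v => ?_
    rw [ContinuousLinearMap.adjoint_inner_right, ← hαβ]
    simp [inner_add_right, N.inner_JT_JN]
  have hβ : ‖β‖ ≤ ‖(normalSub M p).starProjection u‖ := by
    have hprox : IsProximalNormal M p (N.JN β) := by
      have := N.isProximalNormal 0 N.zero_mem β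
      rwa [N.ψ_zero, N.ν_zero_apply] at this
    have h8 : ⟪N.JN β, u - (normalSub M p).starProjection u⟫ = 0 :=
      (normalSub M p).sub_starProjection_mem_orthogonal u _ (Submodule.subset_span hprox)
    have h9 : ⟪N.JN β, u⟫ = ‖β‖ ^ 2 := by
      have h10 := N.inner_JT_JN α β
      rw [real_inner_comm] at h10
      rw [← hαβ, inner_add_right, h10, real_inner_self_eq_norm_sq, N.JN.norm_map, zero_add]
    rw [inner_sub_right, h9] at h8
    have h11 := real_inner_le_norm (N.JN β) ((normalSub M p).starProjection u)
    rw [N.JN.norm_map] at h11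
    rcases (norm_nonneg β).eq_or_lt with h0 | h0
    · rw [← h0]; positivity
    · exact le_of_mul_le_mul_left (by nlinarith) h0
  rw [hα, ← hαβ, N.norm_sq_JT_add_JN, hαβ]
  gcongr

end NormalParam

variable {τ : ℝ} (hM : IsCompact M) (hMd : IsC2Submanifold d M)
  (H : thickening τ M ⊆ uniqueNearestSet M) (hτ : 0 < τ)

include hM hMd H hτ

/-- The normal spaces vary at speed at most `1 / τ`. -/
theorem eventually_norm_starProjection_normalSub_sub_le (hdD : d ≤ D) (hp : p ∈ M) {c : ℝ}
    (hc : 1 / τ < c) : ∀ᶠ x in 𝓝[M] p,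
      ‖(normalSub M x).starProjection - (normalSub M p).starProjection‖ ≤ c * ‖x - p‖ := by
  obtain ⟨N⟩ := nonempty_normalParam hMd hp
  obtain ⟨c', hc', hc'c⟩ := exists_between hc
  have hc'0 : 0 < c' := lt_trans (by positivity) hc'
  obtain ⟨K, hK, hKc⟩ : ∃ K : ℝ, 1 < K ∧ c' * K * K < c := by
    have h1 : ContinuousAt (fun K : ℝ => c' * K * K) 1 := by fun_prop
    have h2 : ∀ᶠ K : ℝ in 𝓝[>] 1, c' * K * K < c :=
      nhdsWithin_le_nhds (h1.eventually (gt_mem_nhds (by simpa using hc'c)))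
    obtain ⟨K, h3, h4⟩ := (h2.and self_mem_nhdsWithin).exists
    exact ⟨K, h4, h3⟩
  obtain ⟨V₁, hV₁, h₁⟩ := N.exists_nhds_dist_le hK
  obtain ⟨V, hV, hVo, h0⟩ := _root_.mem_nhds_iff.1 (inter_mem
    (inter_mem hV₁ (N.mem_nhds N.zero_mem))
    (((N.eventually_abs_inner_JT_ν_le hM H hτ hc').and
      (N.eventually_abs_inner_fderiv_JN_le hM H hτ hc')).and
      ((N.eventually_norm_ν_le hK).and (N.eventually_norm_fderiv_ψ_le hK))))
  obtain ⟨O, hO, hVO⟩ := N.exists_image_eq V (fun w hw => (hV hw).1.2) hVo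
  have hpO : p ∈ O := by
    have : N.ψ 0 ∈ M ∩ O := hVO ▸ mem_image_of_mem _ h0
    rw [N.ψ_zero] at this
    exact this.2
  filter_upwards [self_mem_nhdsWithin, mem_nhdsWithin_of_mem_nhds (hO.mem_nhds hpO)] with x hxM hxO
  obtain ⟨w, hw, rfl⟩ : x ∈ N.ψ '' V := hVO ▸ ⟨hxM, hxO⟩
  obtain ⟨⟨hw1, hwW⟩, ⟨hJν, hDJ⟩, hν, hD⟩ := hV hw
  have hwp : ‖w‖ ≤ K * ‖N.ψ w - p‖ := by
    have := (h₁ w hw1 0 (hV h0).1.1).2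
    rwa [dist_zero_right, N.ψ_zero, dist_eq_norm] at this
  have hK0 : 0 < K := by linarith
  have hbound : c' * ‖w‖ * K ≤ c * ‖N.ψ w - p‖ := by
    calc c' * ‖w‖ * K ≤ c' * (K * ‖N.ψ w - p‖) * K := by gcongr
      _ = c' * K * K * ‖N.ψ w - p‖ := by ring
      _ ≤ _ := by gcongr
  refine norm_starProjection_sub_le _ _ (by have := hc'0.trans hc'c; positivity) ?_ ?_
  · intro k hk l hl
    rw [N.normalSub_eq hdD hwW] at hk
    obtain ⟨t, rfl⟩ := hk
    rw [← N.ψ_zero] at hl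
    obtain ⟨ξ, rfl⟩ := N.exists_fderiv_eq hdD N.zero_mem hl
    rw [N.fderiv_ψ_zero, real_inner_comm]
    change |⟪N.JT ξ, N.ν w t⟫| ≤ _ * ‖N.ν w t‖ * ‖N.JT ξ‖
    rw [N.JT.norm_map]
    calc _ ≤ _ := hJν ξ t
      _ ≤ c' * ‖w‖ * ‖ξ‖ * (K * ‖N.ν w t‖) := by gcongr; exact (hν t).2
      _ = c' * ‖w‖ * K * ‖N.ν w t‖ * ‖ξ‖ := by ring
      _ ≤ _ := by gcongr
  · intro k hk l hl
    obtain ⟨ξ, rfl⟩ := N.exists_fderiv_eq hdD hwW hk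
    rw [← N.ψ_zero, N.normalSub_eq hdD N.zero_mem] at hl
    obtain ⟨t, rfl⟩ := hl
    rw [N.ν_zero]
    change |⟪fderiv ℝ N.ψ w ξ, N.JN t⟫| ≤ _ * ‖fderiv ℝ N.ψ w ξ‖ * ‖N.JN t‖
    rw [N.JN.norm_map]
    calc _ ≤ _ := hDJ ξ t
      _ ≤ c' * ‖w‖ * (K * ‖fderiv ℝ N.ψ w ξ‖) * ‖t‖ := by gcongr; exact (hD ξ).2
      _ = c' * ‖w‖ * K * ‖fderiv ℝ N.ψ w ξ‖ * ‖t‖ := by ring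
      _ ≤ _ := by gcongr

/-- Every point of the segment from `y` to `a` is within `r = ‖a - y‖ / 2` of an endpoint. Its
projection is thus a curve in `M` with Lipschitz constant `‖a - y‖ / (1 - r / τ)`, along which the
normal space turns at rate at most `1 / τ`. -/
theorem norm_starProjection_normalSub_sub_le (hdD : d ≤ D) {y a : EucSp D} (hy : y ∈ M)
    (ha : a ∈ M) (hya : ‖a - y‖ < 2 * τ) :
    ‖(normalSub M a).starProjection - (normalSub M y).starProjection‖ ≤
      ‖a - y‖ / (τ - ‖a - y‖ / 2) := by
  set r := ‖a - y‖ / 2 with hr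
  have hr0 : 0 ≤ r := by positivity
  have hrτ : r < τ := by linarith
  set z : ℝ → EucSp D := fun t => y + t • (a - y) with hz
  have hzr : ∀ t ∈ Icc (0 : ℝ) 1, infDist (z t) M ≤ r := by
    intro t ht
    rcases le_total t (1 / 2) with h | h
    · refine (infDist_le_dist_of_mem hy).trans ?_
      rw [dist_eq_norm, hz, add_sub_cancel_left, norm_smul, Real.norm_eq_abs, abs_of_nonneg ht.1]
      nlinarith [norm_nonneg (a - y)]
    · refine (infDist_le_dist_of_mem ha).trans ?_
      rw [dist_eq_norm, show z t - a = -((1 - t) • (a - y)) by rw [hz]; module, norm_neg,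
        norm_smul, Real.norm_eq_abs, abs_of_nonneg (by linarith [ht.2])]
      nlinarith [norm_nonneg (a - y)]
  have hzt : ∀ t ∈ Icc (0 : ℝ) 1, z t ∈ thickening τ M := fun t ht =>
    mem_thickening_of_infDist_lt ⟨y, hy⟩ ((hzr t ht).trans_lt hrτ)
  set c : ℝ → EucSp D := fun t => nearestPointProj M (z t) with hc
  have hcM : ∀ t ∈ Icc (0 : ℝ) 1, c t ∈ M := fun t ht =>
    (isNearestPoint_nearestPointProj H (hzt t ht)).1
  have hproj : ∀ x ∈ M, nearestPointProj M x = x := fun x hx =>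
    (IsNearestPoint.eq_nearestPointProj H
      (mem_thickening_of_infDist_lt ⟨x, hx⟩ (by rwa [infDist_zero_of_mem hx]))
      ⟨hx, by rw [dist_self, infDist_zero_of_mem hx]⟩).symm
  have hc0 : c 0 = y := by simp [hc, hz, hproj y hy]
  have hc1 : c 1 = a := by simp [hc, hz, hproj a ha]
  have hfac : 0 < 1 - r / τ := by rw [sub_pos, div_lt_one hτ]; exact hrτ
  set ℓ := ‖a - y‖ / (1 - r / τ) with hℓ
  have hℓ0 : 0 ≤ ℓ := by positivity
  have hcLip : ∀ s ∈ Icc (0 : ℝ) 1, ∀ t ∈ Icc (0 : ℝ) 1, ‖c s - c t‖ ≤ ℓ * |s - t| := by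
    intro s hs t ht
    have h1 := norm_nearestPointProj_sub_le hM H hτ (hzt s hs) (hzt t ht) (hzr s hs) (hzr t ht)
    have h2 : ‖z s - z t‖ = |s - t| * ‖a - y‖ := by
      rw [show z s - z t = (s - t) • (a - y) by rw [hz]; module, norm_smul, Real.norm_eq_abs]
    rw [h2] at h1
    rw [hℓ, div_mul_eq_mul_div, le_div_iff₀ hfac]
    linarith
  have hcc : ContinuousOn c (Icc 0 1) :=
    (LipschitzOnWith.of_dist_le_mul (K := ℓ.toNNReal) fun s hs t ht => by
      rw [dist_eq_norm, Real.dist_eq, Real.coe_toNNReal _ hℓ0]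
      exact hcLip s hs t ht).continuousOn
  set Q : ℝ → EucSp D →L[ℝ] EucSp D := fun t => (normalSub M (c t)).starProjection with hQ
  have hloc : ∀ κ, 1 / τ < κ → ∀ t ∈ Icc (0 : ℝ) 1, ∀ᶠ s in 𝓝[Icc 0 1] t,
      ‖Q s - Q t‖ ≤ κ * ℓ * |s - t| := by
    intro κ hκ t ht
    have hκ0 : 0 < κ := lt_trans (by positivity) hκ
    have h1 : Tendsto c (𝓝[Icc 0 1] t) (𝓝[M] (c t)) :=
      tendsto_nhdsWithin_of_tendsto_nhds_of_eventually_within _ (hcc t ht)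
        (eventually_mem_nhdsWithin.mono hcM)
    filter_upwards [h1.eventually (eventually_norm_starProjection_normalSub_sub_le hM hMd H hτ hdD
      (hcM t ht) hκ), self_mem_nhdsWithin] with s hs hs'
    refine hs.trans ?_
    rw [mul_assoc]
    exact mul_le_mul_of_nonneg_left (hcLip s hs' t ht) hκ0.le
  have hQc : ContinuousOn Q (Icc 0 1) := by
    intro t ht
    rw [ContinuousWithinAt, tendsto_iff_norm_sub_tendsto_zero]
    refine squeeze_zero' (Eventually.of_forall fun _ => norm_nonneg _)
      (hloc (1 / τ + 1) (by linarith) t ht) ?_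
    have : Continuous fun s : ℝ => (1 / τ + 1) * ℓ * |s - t| := by fun_prop
    have h2 := (this.tendsto t).mono_left (nhdsWithin_le_nhds (s := Icc 0 1))
    simpa using h2
  -- The extra `κ - 1 / τ` gives the strict slope inequality that the comparison principle requires;
  -- it vanishes as `κ` tends to `1 / τ`.
  have key : ∀ κ, 1 / τ < κ → ‖Q 1 - Q 0‖ ≤ κ * ℓ + (κ - 1 / τ) := by
    intro κ hκ
    have h := image_norm_le_of_liminf_right_slope_norm_lt_deriv_boundary
      (f := fun t => Q t - Q 0) (f' := fun _ => κ * ℓ) (a := 0) (b := 1)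
      (B := fun t => (κ * ℓ + (κ - 1 / τ)) * t) (B' := fun _ => κ * ℓ + (κ - 1 / τ))
      (hQc.sub continuousOn_const) ?_ (by simp) (by fun_prop)
      (fun t _ => by simpa using ((hasDerivAt_id t).const_mul (κ * ℓ + (κ - 1 / τ))).hasDerivWithinAt)
      (fun t _ _ => by linarith) (right_mem_Icc.2 zero_le_one)
    · simpa using h
    · intro t ht ρ hρ
      have h1 : ∀ᶠ s in 𝓝[>] t, s ∈ Icc (0 : ℝ) 1 ∧ t < s := by
        filter_upwards [Ioo_mem_nhdsGT ht.2] with s hs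
        exact ⟨⟨ht.1.trans hs.1.le, hs.2.le⟩, hs.1⟩
      have h2 : 𝓝[>] t ≤ 𝓝[Icc 0 1] t := by
        rw [← nhdsWithin_Ioo_eq_nhdsGT ht.2]
        exact nhdsWithin_mono _ fun s hs => ⟨ht.1.trans hs.1.le, hs.2.le⟩
      have h0 : ∀ᶠ s in 𝓝[>] t, ‖Q s - Q t‖ ≤ κ * ℓ * |s - t| := h2 (hloc κ hκ t ⟨ht.1, ht.2.le⟩)
      refine ((h0.and h1).mono fun s hs => ?_).frequently
      refine lt_of_le_of_lt ?_ hρ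
      have h3 : 0 < s - t := by linarith [hs.2.2]
      rw [slope_def_field, div_le_iff₀ h3]
      have h4 := hs.1
      rw [abs_of_pos h3] at h4
      refine le_trans ?_ h4
      have h5 := norm_sub_norm_le (Q s - Q 0) (Q t - Q 0)
      rwa [sub_sub_sub_cancel_right] at h5
  have hlim : Tendsto (fun κ : ℝ => κ * ℓ + (κ - 1 / τ)) (𝓝[>] (1 / τ)) (𝓝 (1 / τ * ℓ)) := by
    have : Continuous fun κ : ℝ => κ * ℓ + (κ - 1 / τ) := by fun_prop
    have h2 := (this.tendsto (1 / τ)).mono_left (nhdsWithin_le_nhds (s := Ioi (1 / τ)))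
    simpa using h2
  have hfin := ge_of_tendsto hlim (eventually_mem_nhdsWithin.mono key)
  simp only [hQ, hc0, hc1] at hfin
  refine hfin.trans (le_of_eq ?_)
  have : τ - r ≠ 0 := by linarith
  rw [hℓ]
  field_simp

omit hMd in
-- Federer's inequality applied to the normal component of the chord itself.
theorem norm_starProjection_normalSub_apply_le (N : NormalParam d M p) (hdD : d ≤ D) {q : EucSp D}
    (hq : q ∈ M) : ‖(normalSub M p).starProjection (q - p)‖ ≤ ‖q - p‖ ^ 2 / (2 * τ) := by
  set K := normalSub M p with hK
  set v := K.starProjection (q - p) with hv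
  have hvK : v ∈ K := K.starProjection_apply_mem _
  have h1 := (N.isProximalNormal_of_mem_normalSub hdD hvK).inner_le hM H hτ hq
  have h2 : ⟪q - p, v⟫ = ‖v‖ ^ 2 := by
    have h3 : ⟪v, q - p - v⟫ = 0 := K.sub_starProjection_mem_orthogonal (q - p) v hvK
    rw [inner_sub_right, real_inner_self_eq_norm_sq] at h3
    rw [real_inner_comm]; linarith
  rw [h2, mul_div_assoc] at h1
  rcases (norm_nonneg v).eq_or_lt with h0 | h0
  · rw [← h0]; positivity
  · exact le_of_mul_le_mul_left (by nlinarith) h0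

/-- The normal part of the chord at `a` contributes `ρ / τ`, because `‖b - a‖ ≤ 2 * ρ`; turning the
normal space from `a` to `y` contributes the other term. -/
theorem norm_starProjection_normalSub_sub_apply_le (hdD : d ≤ D) {y a b : EucSp D} (hy : y ∈ M)
    (ha : a ∈ M) (hb : b ∈ M) {ρ : ℝ} (hρτ : ρ < 2 * τ) (hay : ‖a - y‖ < ρ) (hby : ‖b - y‖ < ρ) :
    ‖(normalSub M y).starProjection (b - a)‖ ≤
      (ρ / τ + ρ / τ / (1 - ρ / τ / 2)) * ‖b - a‖ := by
  set u := b - a with hu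
  obtain ⟨Na⟩ := nonempty_normalParam hMd ha
  have h1 := norm_starProjection_normalSub_apply_le hM H hτ Na hdD hb
  have h2 := norm_starProjection_normalSub_sub_le hM hMd H hτ hdD hy ha (by linarith)
  have hu2 : ‖u‖ ≤ 2 * ρ := by
    have := norm_sub_le (b - y) (a - y)
    rw [sub_sub_sub_cancel_right] at this
    linarith
  have h3 : ‖u‖ ^ 2 / (2 * τ) ≤ ρ / τ * ‖u‖ := by
    rw [div_mul_eq_mul_div, div_le_div_iff₀ (by positivity) hτ]
    have := mul_le_mul_of_nonneg_left hu2 (mul_nonneg (norm_nonneg u) hτ.le)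
    nlinarith
  have h4 : ‖a - y‖ / (τ - ‖a - y‖ / 2) ≤ ρ / τ / (1 - ρ / τ / 2) := by
    have h5 : ρ / τ / (1 - ρ / τ / 2) = ρ / (τ - ρ / 2) := by
      rw [div_div, mul_sub, mul_one, mul_div_assoc', mul_div_cancel₀ _ hτ.ne']
    rw [h5]
    have : 0 < τ - ρ / 2 := by linarith
    have := (norm_nonneg (a - y)).trans hay.le
    gcongr
  have h7 : (normalSub M y).starProjection u = (normalSub M a).starProjection u -
      ((normalSub M a).starProjection - (normalSub M y).starProjection) u := by simp
  rw [h7, add_mul]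
  refine (norm_sub_le _ _).trans (add_le_add (h1.trans h3) ?_)
  exact (ContinuousLinearMap.le_opNorm _ _).trans
    (mul_le_mul_of_nonneg_right (h2.trans h4) (norm_nonneg u))

/-- Orthogonal projection to the tangent space at `y` maps the piece into a `d`-ball of radius `ρ`.
The bound on normal components makes its inverse Lipschitz with constant `√(1 + q ^ 2)`, where `q =
2 * ρ / (τ - 2 * ρ)`. -/
theorem euclideanHausdorffMeasure_inter_ball_le (hdD : d ≤ D) {y : EucSp D} (hy : y ∈ M) {ρ : ℝ}
    (hρ : 0 < ρ) (hρτ : ρ ≤ τ / 8) :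
    (μHE[d] : Measure (EucSp D)) (M ∩ ball y ρ) ≤
      ENNReal.ofReal ((1 + (2 * ρ / (τ - 2 * ρ)) ^ 2) ^ ((d : ℝ) / 2)) *
        volume (ball (0 : EucSp d) ρ) := by
  obtain ⟨N⟩ := nonempty_normalParam hMd hy
  have hx0 : 0 < ρ / τ := by positivity
  have hx8 : ρ / τ ≤ 1 / 8 := by rw [div_le_iff₀ hτ]; linarith
  have hqx : 2 * ρ / (τ - 2 * ρ) = 2 * (ρ / τ) / (1 - 2 * (ρ / τ)) := by
    have : τ - 2 * ρ ≠ 0 := by linarith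
    field_simp
  have hsq := one_le_one_sub_sq_mul_one_add_sq hx0 hx8
  rw [← hqx] at hsq
  have hs0 : 0 ≤ ρ / τ + ρ / τ / (1 - ρ / τ / 2) := by
    have : 0 < 1 - ρ / τ / 2 := by linarith
    positivity
  generalize 2 * ρ / (τ - 2 * ρ) = q at hsq ⊢
  have hexp : ∀ a ∈ M ∩ ball y ρ, ∀ b ∈ M ∩ ball y ρ, ‖a - b‖ ≤ √(1 + q ^ 2) *
      ‖ContinuousLinearMap.adjoint N.JT.toContinuousLinearMap (a - b)‖ := by
    rintro a ⟨haM, hay⟩ b ⟨hbM, hby⟩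
    rw [mem_ball, dist_eq_norm] at hay hby
    have h1 := norm_starProjection_normalSub_sub_apply_le hM hMd H hτ hdD hy hbM haM
      (by linarith) hby hay
    have h2 := N.norm_sq_le_add hdD (a - b)
    generalize ρ / τ + ρ / τ / (1 - ρ / τ / 2) = s at hsq hs0 h1
    have h3 := pow_le_pow_left₀ (norm_nonneg _) h1 2
    rw [mul_pow] at h3
    refine le_of_sq_le_sq ?_ (by positivity)
    rw [mul_pow, Real.sq_sqrt (by positivity)]
    have h4 : (1 - s ^ 2) * ‖a - b‖ ^ 2 ≤
        ‖ContinuousLinearMap.adjoint N.JT.toContinuousLinearMap (a - b)‖ ^ 2 := by linarith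
    have h5 := mul_le_mul_of_nonneg_left h4 (show 0 ≤ 1 + q ^ 2 by positivity)
    have h6 := mul_le_mul_of_nonneg_right hsq (sq_nonneg ‖a - b‖)
    linarith
  have himage : ContinuousLinearMap.adjoint N.JT.toContinuousLinearMap '' (M ∩ ball y ρ) ⊆
      ball (ContinuousLinearMap.adjoint N.JT.toContinuousLinearMap y) ρ := by
    rintro _ ⟨a, ⟨-, hay⟩, rfl⟩
    rw [mem_ball, dist_eq_norm] at hay ⊢
    rw [← map_sub]
    exact (N.norm_adjoint_JT_le _).trans_lt hay
  have hmeas := euclideanHausdorffMeasure_le_of_edist_le (K := (√(1 + q ^ 2)).toNNReal)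
    (f := ContinuousLinearMap.adjoint N.JT.toContinuousLinearMap)
    (s := M ∩ ball y ρ) (fun a ha b hb => by
      rw [edist_dist, edist_dist]
      change _ ≤ ENNReal.ofReal _ * _
      rw [← ENNReal.ofReal_mul (by positivity), dist_eq_norm, dist_eq_norm, ← map_sub]
      exact ENNReal.ofReal_le_ofReal (hexp a ha b hb)) d
  have hpow : ((√(1 + q ^ 2)).toNNReal : ℝ≥0∞) ^ d =
      ENNReal.ofReal ((1 + q ^ 2) ^ ((d : ℝ) / 2)) := by
    change ENNReal.ofReal _ ^ d = _
    rw [← ENNReal.ofReal_pow (by positivity), Real.sqrt_eq_rpow, ← Real.rpow_natCast,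
      ← Real.rpow_mul (by positivity)]
    congr 2; ring
  rw [hpow, EuclideanSpace.euclideanHausdorffMeasure_eq_volume d] at hmeas
  refine hmeas.trans (mul_le_mul_right ((measure_mono himage).trans_eq ?_) _)
  exact Measure.addHaar_ball_center volume _ _

end Normal

/-! ### The two volume estimates. -/

theorem mainTheorem4 {D d : ℕ} (hdD : d ≤ D) (M : Set (EucSp D)) (hM : IsCompact M)
    (hMd : IsC2Submanifold d M) (τ : ℝ) (hτ : reach M = ENNReal.ofReal τ)
    (σ : ℝ) (hσ : 0 ≤ σ) (hστ : σ < τ) :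
    (∀ U : Set (EucSp D), U ⊆ M → NullMeasurableSet U (volM d M) →
      ENNReal.ofReal ((1 - σ / τ) ^ d) * volM d M U *
          volume (Metric.ball (0 : EucSp (D - d)) σ) ≤ volume (tubePreimage M σ U) ∧
        volume (tubePreimage M σ U) ≤
          ENNReal.ofReal ((1 + σ / τ) ^ d) * volM d M U *
            volume (Metric.ball (0 : EucSp (D - d)) σ)) ∧
      ∀ y ∈ M, ∀ r : ℝ, r + σ ≤ τ / 8 →
        volume (Metric.thickening σ M ∩ Metric.ball y r) ≤
          ENNReal.ofReal ((1 + σ / τ) ^ d *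
              (1 + (2 * (r + σ) / (τ - 2 * (r + σ))) ^ 2) ^ ((d : ℝ) / 2)) *
            volume (Metric.ball (0 : EucSp d) (r + σ)) *
            volume (Metric.ball (0 : EucSp (D - d)) σ) := by
  have hτ0 : 0 < τ := hσ.trans_lt hστ
  have H : Metric.thickening τ M ⊆ uniqueNearestSet M :=
    thickening_subset_uniqueNearestSet_of_le hτ.ge
  refine ⟨fun U hUM hU => ⟨le_volume_tubePreimage hM hMd H hτ0 hdD hσ hστ hUM hU,
    volume_tubePreimage_le hM hMd H hτ0 hdD hσ hστ hUM⟩, fun y hy r hr => ?_⟩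
  rcases le_or_gt r 0 with hr0 | hr0
  · rw [Metric.ball_eq_empty.2 hr0]; simp
  -- A foot point is less than `σ` away from its point of the tube, hence less than `r + σ` from
  -- `y`.
  have hsub : Metric.thickening σ M ∩ Metric.ball y r ⊆
      tubePreimage M σ (M ∩ Metric.ball y (r + σ)) := by
    rintro z ⟨hz, hzy⟩
    have hzn := isNearestPoint_nearestPointProj H (Metric.thickening_mono hστ.le M hz)
    refine ⟨hz, hzn.1, ?_⟩
    have h1 := infDist_lt_of_mem_thickening hz
    rw [← hzn.2] at h1
    rw [Metric.mem_ball] at hzy ⊢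
    linarith [dist_triangle (nearestPointProj M z) z y]
  refine (measure_mono hsub).trans
    ((volume_tubePreimage_le hM hMd H hτ0 hdD hσ hστ Set.inter_subset_left).trans ?_)
  rw [volM, Measure.restrict_eq_self _ Set.inter_subset_left, ENNReal.ofReal_mul (by positivity),
    mul_assoc (ENNReal.ofReal ((1 + σ / τ) ^ d)) (ENNReal.ofReal _) (volume _)]
  exact mul_le_mul_left (mul_le_mul_right (euclideanHausdorffMeasure_inter_ball_le hM hMd H hτ0
    hdD hy (by linarith) hr) _) _
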